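/- Let $H$ be the finite graph consisting of two disjoint copies of $K_{15}$, with vertex sets $\{x_1,\dots,x_{15}\}$ and $\{y_1,\dots,y_{15}\}$, together with the three edges $x_1y_1$, $x_2y_2$, $x_3y_3$. For every positive integer $q$ there is a finite graph $G_q$ such that $H$ is not a $3$-fat minor of $G_q$, but every (possibly infinite) graph $\widehat G$ to which $G_q$ is $q$-quasi-isometric contains $H$ as a $2$-fat minor and also as a minor. In particular, $G_q$ is not $q$-quasi-isometric to any graph with no $2$-fat $H$ minor, nor to any graph with no $H$ minor. Here graphs are simple, $\mathrm{dist}_G$ is the graph distance on $V(G)$ (infinite between different components), and the distance between two vertex sets is the minimum distance between their elements. For a positive integer $K$, $H$ is a *$K$-fat minor* of $G$ if there are non-empty sets $B_v\subseteq V(G)$ $(v\in V(H))$ and $P_e\subseteq V(G)$ $(e\in E(H))$, each inducing a connected subgraph of $G$, such that $B_v\cap P_e\neq\emptyset$ whenever $v$ is an end of $e$, and any two members of this family with distinct indices that are not of the form $B_v,P_e$ with $v$ an end of $e$ are at distance at least $K$ in $G$. The graph $H$ is a *minor* of $G$ if there are pairwise disjoint non-empty sets $B_v\subseteq V(G)$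 $(v\in V(H))$, each inducing a connected subgraph of $G$, such that $G$ has an edge between $B_u$ and $B_v$ whenever $uv\in E(H)$. The graph $G$ is *$q$-quasi-isometric* to $\widehat G$ if there is a map $\phi\colon V(G)\to V(\widehat G)$ such that $$q^{-1}\,\mathrm{dist}_G(x,y)-q\;\le\;\mathrm{dist}_{\widehat G}(\phi(x),\phi(y))\;\le\; q\,\mathrm{dist}_G(x,y)+q\qquad\text{for all }x,y\in V(G),$$ and every vertex $\widehat v$ of $\widehat G$ satisfies $\mathrm{dist}_{\widehat G}(\widehat v,\phi(v))\le q$ for some $v\in V(G)$. -/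

import Mathlib

open scoped ENNReal

namespace FatMinor

/-- The distance between two vertex sets of a graph: the least length of a path between them
(`⊤` if there is none). -/
noncomputable def setDist {V : Type*} (G : SimpleGraph V) (X Y : Set V) : ℕ∞ :=
  ⨅ x ∈ X, ⨅ y ∈ Y, G.edist x y

/-- A `K`-fat minor model of `H` in `G`: connected branch sets `B v` for the vertices and
connected sets `P e` for the edges of `H`, such that `B v` meets `P e` whenever `v` is an end
of `e`, and all other pairs of distinct members of the family are at distance at least `K`. -/
structure IsFatMinorModel {α V : Type*} (K : ℕ) (H : SimpleGraph α) (G : SimpleGraph V)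
    (B : α → Set V) (P : H.edgeSet → Set V) : Prop where
  connected_branch : ∀ v, (G.induce (B v)).Connected
  connected_edge : ∀ e, (G.induce (P e)).Connected
  meet : ∀ v (e : H.edgeSet), v ∈ (e : Sym2 α) → (B v ∩ P e).Nonempty
  branch_branch : ∀ u v, u ≠ v → (K : ℕ∞) ≤ setDist G (B u) (B v)
  edge_edge : ∀ e f, e ≠ f → (K : ℕ∞) ≤ setDist G (P e) (P f)
  branch_edge : ∀ v (e : H.edgeSet), v ∉ (e : Sym2 α) → (K : ℕ∞) ≤ setDist G (B v) (P e)

/-- `H` is a `K`-fat minor of `G`. -/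
def IsFatMinor {α V : Type*} (K : ℕ) (H : SimpleGraph α) (G : SimpleGraph V) : Prop :=
  ∃ (B : α → Set V) (P : H.edgeSet → Set V), IsFatMinorModel K H G B P

/-- `H` is a minor of `G`: there are pairwise disjoint connected branch sets, one for each vertex
of `H`, with an edge of `G` between any two branch sets of adjacent vertices of `H`. -/
def IsMinor {α V : Type*} (H : SimpleGraph α) (G : SimpleGraph V) : Prop :=
  ∃ B : α → Set V,
    (∀ v, (G.induce (B v)).Connected) ∧
    (∀ u v, u ≠ v → Disjoint (B u) (B v)) ∧
    (∀ u v, H.Adj u v → ∃ x ∈ B u, ∃ y ∈ B v, G.Adj x y)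

/-- `φ` is a `q`-quasi-isometry of the graph `G` into the graph `G'`, for the graph distances
(with value `∞` between different components). The subtraction is the truncated one, which
makes no difference since the right-hand side is nonnegative. -/
structure IsQuasiIsometry {V W : Type*} (q : ℕ) (G : SimpleGraph V) (G' : SimpleGraph W)
    (φ : V → W) : Prop where
  lower : ∀ x y, (q : ℝ≥0∞)⁻¹ * (G.edist x y : ℝ≥0∞) - q ≤ (G'.edist (φ x) (φ y) : ℝ≥0∞)
  upper : ∀ x y, (G'.edist (φ x) (φ y) : ℝ≥0∞) ≤ q * (G.edist x y : ℝ≥0∞) + q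
  dense : ∀ w, ∃ v, (G'.edist w (φ v) : ℝ≥0∞) ≤ q

/-- `G` is `q`-quasi-isometric to `G'`. -/
def IsQuasiIsometric {V W : Type*} (q : ℕ) (G : SimpleGraph V) (G' : SimpleGraph W) : Prop :=
  ∃ φ : V → W, IsQuasiIsometry q G G' φ

/-- Two disjoint copies of `K₁₅`, on `x₀, …, x₁₄` (left) and `y₀, …, y₁₄` (right), together with
the three edges `x₀y₀`, `x₁y₁`, `x₂y₂`. -/
def linkedK15 : SimpleGraph (Fin 15 ⊕ Fin 15) where
  Adj
    | .inl i, .inl j => i ≠ j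
    | .inr i, .inr j => i ≠ j
    | .inl i, .inr j => i = j ∧ (i : ℕ) < 3
    | .inr i, .inl j => i = j ∧ (i : ℕ) < 3
  symm := ⟨by
    rintro (i | i) (j | j) h
    · exact Ne.symm h
    · obtain ⟨rfl, h⟩ := h; exact ⟨rfl, h⟩
    · obtain ⟨rfl, h⟩ := h; exact ⟨rfl, h⟩
    · exact Ne.symm h⟩
  loopless := ⟨by rintro (i | i) h <;> exact h rfl⟩

end FatMinor

/-! The graph `fatGraph n L` consists of a binary tree of depth `n` with an apex above its root, a
row of nodes below the leaves, and two copies of `K₁₅`, with long paths in place of the edges of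
the cliques and of the connections between neighbouring columns, a column being a leaf together
with the row node below it. Each clique is attached by long paths to the two nodes of an end column
and to the apex.

In a `3`-fat model of `linkedK15` the branch sets of a complete subgraph on 15 vertices cannot be
separated by the few nodes where a clique of the graph is attached, nor fit into the part with the
tree, so each of them contains a vertex of the same clique of the graph, a different one for each
of the two complete subgraphs. Contracting the long paths turns the three edges between them into
three disjoint connections of the two cliques. Since a column has only two nodes, one of these
connections uses the apex. The other two cross all columns, and by induction on the height of a
subtree, its root belongs to one of two such crossing connections. Hence the root of the whole
tree, a neighbour of the apex, belongs to a connection other than the one through the apex, and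
these two are not far apart.

Given a quasi-isometry to `G'`, remove a large ball around the image of the apex from a
neighborhood of the image of the tree, and label each leaf by the component that contains its
image. The images of the long paths are then far apart, except where the paths have a common end or
end at leaves with the same label. Two connections with disjoint sets of labels can still be routed
through the columns: one stays at its label while the other one follows the row, and they change
places at the last leaf with this label. The third connection goes through the apex. Neighborhoods
of the images of the long paths used, together with the components at their leaves, form a `2`-fat
model in `G'`, and every fat model yields a minor. -/

namespace FatMinor

section Connectivity

variable {V ι : Type*} {G : SimpleGraph V} {R S X : Set V} {x y : V}

theorem preconnected_induce_iff_forall_subset :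
    (G.induce R).Preconnected ↔
      ∀ X : Set V, (∀ u ∈ R ∩ X, ∀ w ∈ R, G.Adj u w → w ∈ X) → (R ∩ X).Nonempty → R ⊆ X := by
  constructor
  · rintro hR X hX ⟨u, hu, huX⟩ w hw
    by_contra hwX
    obtain ⟨p⟩ := hR ⟨u, hu⟩ ⟨w, hw⟩
    obtain ⟨d, -, hd, hd'⟩ := p.exists_boundary_dart {z | z.1 ∈ X} huX hwX
    exact hd' (hX d.fst ⟨d.fst.2, hd⟩ d.snd d.snd.2 d.adj)
  · rintro h ⟨u, hu⟩ ⟨w, hw⟩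
    obtain ⟨_, hr⟩ := h {z | ∃ hz : z ∈ R, (G.induce R).Reachable ⟨u, hu⟩ ⟨z, hz⟩}
      (fun a ha b hb hab => ⟨hb, ha.2.choose_spec.trans (SimpleGraph.Adj.reachable hab)⟩)
      ⟨u, hu, hu, .rfl⟩ hw
    exact hr

theorem subset_or_disjoint_of_preconnected (hR : (G.induce R).Preconnected)
    (hX : ∀ u ∈ R ∩ X, ∀ w ∈ R, G.Adj u w → w ∈ X) : R ⊆ X ∨ Disjoint R X := by
  rw [or_iff_not_imp_right, Set.not_disjoint_iff_nonempty_inter]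
  exact preconnected_induce_iff_forall_subset.1 hR X hX

theorem exists_adj_of_preconnected (hR : (G.induce R).Preconnected) (hx : x ∈ R ∩ X)
    (hy : y ∈ R \ X) : ∃ u ∈ R ∩ X, ∃ w ∈ R \ X, G.Adj u w := by
  by_contra! h
  refine hy.2 (preconnected_induce_iff_forall_subset.1 hR X (fun u hu w hw huw => ?_) ⟨x, hx⟩ hy.1)
  by_contra hwX
  exact h u hu w ⟨hw, hwX⟩ huw

theorem preconnected_induce_singleton (x : V) : (G.induce {x}).Preconnected :=
  SimpleGraph.Preconnected.of_subsingleton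

theorem preconnected_induce_image {V' : Type*} {H : SimpleGraph V'} (f : G →g H)
    (hR : (G.induce R).Preconnected) :
    (H.induce (f '' R)).Preconnected := by
  rw [preconnected_induce_iff_forall_subset] at hR ⊢
  rintro X hX ⟨_, ⟨x, hx, rfl⟩, hxX⟩
  exact Set.image_subset_iff.2 (hR (f ⁻¹' X) (fun u hu w hw huw => hX _
    ⟨Set.mem_image_of_mem f hu.1, hu.2⟩ _ (Set.mem_image_of_mem f hw) (f.map_adj huw))
    ⟨x, hx, hxX⟩)

theorem preconnected_induce_biUnion {H : SimpleGraph ι} {I : Set ι} {F : ι → Set V}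
    (hI : (H.induce I).Preconnected) (hF : ∀ i ∈ I, (G.induce (F i)).Preconnected)
    (hH : ∀ i ∈ I, ∀ j ∈ I, H.Adj i j → (F i ∩ F j).Nonempty) :
    (G.induce (⋃ i ∈ I, F i)).Preconnected := by
  rw [preconnected_induce_iff_forall_subset]
  rintro X hX ⟨x, hx, hxX⟩
  have subset_of_meets : ∀ i ∈ I, (F i ∩ X).Nonempty → F i ⊆ X := fun i hi =>
    preconnected_induce_iff_forall_subset.1 (hF i hi) X fun u hu w hw =>
      hX u ⟨Set.mem_biUnion hi hu.1, hu.2⟩ w (Set.mem_biUnion hi hw)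
  obtain ⟨i, hi, hxi⟩ := Set.mem_iUnion₂.1 hx
  refine Set.iUnion₂_subset (preconnected_induce_iff_forall_subset.1 hI {i | F i ⊆ X} ?_
    ⟨i, hi, subset_of_meets i hi ⟨x, hxi, hxX⟩⟩)
  rintro j ⟨hj, hjX⟩ k hk hjk
  obtain ⟨z, hzj, hzk⟩ := hH j hj k hk hjk
  exact subset_of_meets k hk ⟨z, hzk, hjX hzj⟩

theorem preconnected_induce_union_biUnion {I : Set ι} {F : ι → Set V}
    (hR : (G.induce R).Preconnected) (hF : ∀ i ∈ I, (G.induce (F i)).Preconnected)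
    (hRF : ∀ i ∈ I, (R ∩ F i).Nonempty) : (G.induce (R ∪ ⋃ i ∈ I, F i)).Preconnected := by
  rw [preconnected_induce_iff_forall_subset]
  rintro X hX ⟨x, hx, hxX⟩
  have hR_or := subset_or_disjoint_of_preconnected hR (X := X)
    fun u hu w hw => hX u ⟨Or.inl hu.1, hu.2⟩ w (Or.inl hw)
  have hF_or : ∀ i ∈ I, F i ⊆ X ∨ Disjoint (F i) X := fun i hi =>
    subset_or_disjoint_of_preconnected (hF i hi) fun u hu w hw =>
      hX u ⟨Or.inr (Set.mem_biUnion hi hu.1), hu.2⟩ w (Or.inr (Set.mem_biUnion hi hw))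
  have subset_iff : ∀ i ∈ I, F i ⊆ X ↔ R ⊆ X := by
    intro i hi
    obtain ⟨z, hzR, hzF⟩ := hRF i hi
    exact ⟨fun h => hR_or.resolve_right fun h' => h'.notMem_of_mem_left hzR (h hzF),
      fun h => (hF_or i hi).resolve_right fun h' => h'.notMem_of_mem_left hzF (h hzR)⟩
  have hRX : R ⊆ X := by
    rcases hx with hx | hx
    · exact hR_or.resolve_right fun h => h.notMem_of_mem_left hx hxX
    · obtain ⟨i, hi, hxi⟩ := Set.mem_iUnion₂.1 hx
      exact (subset_iff i hi).1 ((hF_or i hi).resolve_right fun h => h.notMem_of_mem_left hxi hxX)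
  exact Set.union_subset hRX (Set.iUnion₂_subset fun i hi => (subset_iff i hi).2 hRX)

theorem preconnected_induce_insert (hR : (G.induce R).Preconnected) (hy : y ∈ R)
    (hxy : G.Adj y x) : (G.induce (insert x R)).Preconnected := by
  have hpair : (G.induce {x, y}).Preconnected :=
    (SimpleGraph.induce_pair_connected_of_adj hxy.symm).preconnected
  have h := (SimpleGraph.induce_union_connected hpair hR ⟨y, by simp, hy⟩).preconnected
  rwa [Set.insert_union, Set.singleton_union, Set.insert_eq_of_mem hy] at h

theorem preconnected_induce_inter_of_exits {p : V} (hR : (G.induce R).Preconnected)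
    (hexit : ∀ u ∈ R ∩ S, ∀ w ∈ R \ S, G.Adj u w → u = p) : (G.induce (R ∩ S)).Preconnected := by
  rw [preconnected_induce_iff_forall_subset]
  rintro X hX ⟨x, hx, hxX⟩ y hy
  by_contra hyX
  by_cases hp : p ∈ X
  · obtain ⟨u, hu, w, hw, huw⟩ := exists_adj_of_preconnected (X := S \ X) hR ⟨hy.1, hy.2, hyX⟩
      ⟨hx.1, fun h => h.2 hxX⟩
    by_cases hwS : w ∈ S
    · have hwX : w ∈ X := by_contra fun h => hw.2 ⟨hwS, h⟩
      exact hu.2.2 (hX w ⟨⟨hw.1, hwS⟩, hwX⟩ u ⟨hu.1, hu.2.1⟩ huw.symm)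
    · exact hu.2.2 (hexit u ⟨hu.1, hu.2.1⟩ w ⟨hw.1, hwS⟩ huw ▸ hp)
  · obtain ⟨u, hu, w, hw, huw⟩ := exists_adj_of_preconnected (X := S ∩ X) hR ⟨hx.1, hx.2, hxX⟩
      ⟨hy.1, fun h => hyX h.2⟩
    by_cases hwS : w ∈ S
    · exact hw.2 ⟨hwS, hX u ⟨⟨hu.1, hu.2.1⟩, hu.2.2⟩ w ⟨hw.1, hwS⟩ huw⟩
    · exact hp (hexit u ⟨hu.1, hu.2.1⟩ w ⟨hw.1, hwS⟩ huw ▸ hu.2.2)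

end Connectivity

section ComponentIn

variable {V : Type*} {G : SimpleGraph V} {R X : Set V} {x y : V}

/-- The vertex set of the component of `G.induce X` that contains `x`, as a set of vertices of `G`;
it is empty if `x ∉ X`. This is the graph analogue of `connectedComponentIn`. -/
def componentIn (G : SimpleGraph V) (X : Set V) (x : V) : Set V :=
  {y | ∃ (hx : x ∈ X) (hy : y ∈ X), (G.induce X).Reachable ⟨x, hx⟩ ⟨y, hy⟩}

theorem mem_componentIn_self (hx : x ∈ X) : x ∈ componentIn G X x := ⟨hx, hx, .rfl⟩

theorem componentIn_subset : componentIn G X x ⊆ X := fun _ hy => hy.2.1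

theorem mem_componentIn_of_adj (hx : x ∈ componentIn G X y) {z : V} (hz : z ∈ X)
    (hxz : G.Adj x z) : z ∈ componentIn G X y := by
  obtain ⟨hy, hxX, hr⟩ := hx
  exact ⟨hy, hz, hr.trans (SimpleGraph.Adj.reachable (G := G.induce X) (u := ⟨x, hxX⟩) hxz)⟩

theorem componentIn_eq (hy : y ∈ componentIn G X x) : componentIn G X y = componentIn G X x := by
  obtain ⟨hx, hyX, hr⟩ := hy
  ext z
  exact ⟨fun ⟨_, hz, h⟩ => ⟨hx, hz, hr.trans h⟩, fun ⟨_, hz, h⟩ => ⟨hyX, hz, hr.symm.trans h⟩⟩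

theorem subset_componentIn (hR : (G.induce R).Preconnected) (hRX : R ⊆ X) (hyR : y ∈ R)
    (hy : y ∈ componentIn G X x) : R ⊆ componentIn G X x :=
  preconnected_induce_iff_forall_subset.1 hR _
    (fun _ hu _ hw huw => mem_componentIn_of_adj hu.2 (hRX hw) huw) ⟨y, hyR, hy⟩

theorem preconnected_componentIn (X : Set V) (x : V) :
    (G.induce (componentIn G X x)).Preconnected := by
  rw [preconnected_induce_iff_forall_subset]
  rintro Y hY ⟨y, hy, hyY⟩ z hz
  rw [← componentIn_eq hy] at hY hz
  obtain ⟨hyX, hzX, ⟨p⟩⟩ := hz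
  by_contra hzY
  obtain ⟨d, -, hd, hd'⟩ :=
    p.exists_boundary_dart {v | v.1 ∈ componentIn G X y ∩ Y} ⟨mem_componentIn_self hyX, hyY⟩
      fun h => hzY h.2
  have hmem := mem_componentIn_of_adj hd.1 d.snd.2 d.adj
  exact hd' ⟨hmem, hY _ hd _ hmem d.adj⟩

theorem exists_adj_componentIn_inter (hR : (G.induce R).Preconnected) (hx : x ∈ R ∩ X)
    (hX : (R \ X).Nonempty) : ∃ u ∈ componentIn G (R ∩ X) x, ∃ w ∈ R \ X, G.Adj u w := by
  obtain ⟨y, hyR, hyX⟩ := hX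
  obtain ⟨u, ⟨-, hu⟩, w, ⟨hwR, hw⟩, huw⟩ := exists_adj_of_preconnected hR
    ⟨hx.1, mem_componentIn_self hx⟩ ⟨hyR, fun h => hyX (componentIn_subset h).2⟩
  exact ⟨u, hu, w, ⟨hwR, fun hwX => hw (mem_componentIn_of_adj hu ⟨hwR, hwX⟩ huw)⟩, huw⟩

end ComponentIn

section Distance

variable {V : Type*} {G : SimpleGraph V} {X Y : Set V}

theorem le_setDist_iff {d : ℕ∞} :
    d ≤ setDist G X Y ↔ ∀ x ∈ X, ∀ y ∈ Y, d ≤ G.edist x y := by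
  simp only [setDist, le_iInf_iff]

theorem setDist_comm (X Y : Set V) : setDist G X Y = setDist G Y X :=
  iInf₂_comm _ |>.trans (by simp only [setDist, G.edist_comm])

theorem disjoint_of_le_setDist {K : ℕ} (hK : 1 ≤ K) (h : (K : ℕ∞) ≤ setDist G X Y) :
    Disjoint X Y := by
  rw [Set.disjoint_left]
  intro z hx hy
  have hz := le_setDist_iff.1 h z hx z hy
  rw [SimpleGraph.edist_self, nonpos_iff_eq_zero, Nat.cast_eq_zero] at hz
  omega

theorem edist_le_one_iff {x y : V} : G.edist x y ≤ 1 ↔ x = y ∨ G.Adj x y := by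
  rw [Order.le_one_iff, SimpleGraph.edist_eq_zero_iff, SimpleGraph.edist_eq_one_iff_adj]

theorem le_add_edist_of_forall_adj {f : V → ℕ} (hf : ∀ u v, G.Adj u v → f u ≤ f v + 1) (u v : V) :
    (f u : ℕ∞) ≤ f v + G.edist u v := by
  have le_add_length : ∀ {u v} (p : G.Walk u v), f u ≤ f v + p.length := by
    intro u v p
    induction p with
    | nil => exact le_rfl
    | cons h p ih =>
      have := hf _ _ h
      rw [SimpleGraph.Walk.length_cons]
      omega
  by_cases h : G.Reachable u v
  · obtain ⟨p, hp⟩ := h.exists_walk_length_eq_edist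
    rw [← hp]
    exact_mod_cast le_add_length p
  · simp [SimpleGraph.edist_eq_top_of_not_reachable h]

theorem preconnected_induce_ball (c : V) (m : ℕ) :
    (G.induce {w | G.edist w c ≤ m}).Preconnected := by
  rw [preconnected_induce_iff_forall_subset]
  rintro X hX ⟨x, hx, hxX⟩ y hy
  have exists_walk : ∀ {z}, G.edist z c ≤ m → ∃ p : G.Walk z c, p.length ≤ m := by
    intro z hz
    have hr : G.Reachable z c := SimpleGraph.reachable_of_edist_ne_top
      (ne_top_of_le_ne_top (ENat.natCast_ne_top m) hz)
    obtain ⟨p, hp⟩ := hr.exists_walk_length_eq_edist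
    exact ⟨p, by exact_mod_cast hp.trans_le hz⟩
  have mem_iff : ∀ {z c'} (p : G.Walk z c'), c' = c → p.length ≤ m → (z ∈ X ↔ c ∈ X) := by
    intro z c' p hc
    induction p with
    | nil => exact fun _ => by rw [hc]
    | @cons u v d h p ih =>
      subst hc
      rw [SimpleGraph.Walk.length_cons]
      intro hl
      have hu : G.edist u d ≤ m := (h.toWalk.append p).edist_le.trans (by
        rw [SimpleGraph.Walk.length_append, SimpleGraph.Walk.length_cons,
          SimpleGraph.Walk.length_nil]
        exact_mod_cast (by omega))
      have hv : G.edist v d ≤ m := p.edist_le.trans (by exact_mod_cast (by omega))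
      rw [← ih rfl (by omega)]
      exact ⟨fun hX' => hX u ⟨hu, hX'⟩ v hv h, fun hX' => hX v ⟨hv, hX'⟩ u hu h.symm⟩
  obtain ⟨p, hp⟩ := exists_walk hx
  obtain ⟨p', hp'⟩ := exists_walk hy
  rwa [mem_iff p' rfl hp', ← mem_iff p rfl hp]

end Distance

section Minor

variable {α V : Type*} {H : SimpleGraph α} {G : SimpleGraph V} {K : ℕ} {B : α → Set V}
  {P : H.edgeSet → Set V}

namespace IsFatMinorModel

theorem disjoint_branch (M : IsFatMinorModel K H G B P) (hK : 1 ≤ K) {u v : α} (huv : u ≠ v) :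
    Disjoint (B u) (B v) := disjoint_of_le_setDist hK (M.branch_branch u v huv)

theorem disjoint_edge (M : IsFatMinorModel K H G B P) (hK : 1 ≤ K) {e f : H.edgeSet}
    (hef : e ≠ f) : Disjoint (P e) (P f) := disjoint_of_le_setDist hK (M.edge_edge e f hef)

theorem disjoint_branch_edge (M : IsFatMinorModel K H G B P) (hK : 1 ≤ K) {v : α} {e : H.edgeSet}
    (hve : v ∉ (e : Sym2 α)) : Disjoint (B v) (P e) :=
  disjoint_of_le_setDist hK (M.branch_edge v e hve)

theorem exists_half_edge (M : IsFatMinorModel K H G B P) (hK : 1 ≤ K) {u v : α} {e : H.edgeSet}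
    (he : (e : Sym2 α) = s(u, v)) :
    ∃ D ⊆ P e ∩ (B v)ᶜ, (G.induce D).Preconnected ∧ (B u ∩ D).Nonempty ∧
      ∃ x ∈ D, ∃ y ∈ B v, G.Adj x y := by
  have huv : u ≠ v := by
    rintro rfl
    exact H.loopless.irrefl u (he ▸ e.2 : s(u, u) ∈ H.edgeSet)
  obtain ⟨x, hxB, hxP⟩ := M.meet u e (by rw [he]; exact Sym2.mem_mk_left u v)
  obtain ⟨y, hyB, hyP⟩ := M.meet v e (by rw [he]; exact Sym2.mem_mk_right u v)
  have hx : x ∈ P e ∩ (B v)ᶜ := ⟨hxP, (M.disjoint_branch hK huv).notMem_of_mem_left hxB⟩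
  obtain ⟨a, ha, b, hb, hab⟩ :=
    exists_adj_componentIn_inter (M.connected_edge e).preconnected hx
      ⟨y, hyP, Set.notMem_compl_iff.2 hyB⟩
  exact ⟨componentIn G (P e ∩ (B v)ᶜ) x, componentIn_subset, preconnected_componentIn _ _,
    ⟨x, hxB, mem_componentIn_self hx⟩, a, ha, b, Set.notMem_compl_iff.1 hb.2, hab⟩

theorem isMinor (M : IsFatMinorModel K H G B P) (hK : 1 ≤ K) : IsMinor H G := by
  have exists_ends : ∀ e : H.edgeSet, ∃ u v, (e : Sym2 α) = s(u, v) := fun e =>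
    (e : Sym2 α).ind fun u v => ⟨u, v, rfl⟩
  choose o t hends using exists_ends
  choose D hDsub hDconn hDmeet hDadj using fun e => M.exists_half_edge hK (hends e)
  have disjoint_branch_half : ∀ {u e}, u ≠ o e → Disjoint (B u) (D e) := by
    intro u e hu
    by_cases hut : u = t e
    · exact hut ▸ disjoint_compl_right.mono_right ((hDsub e).trans Set.inter_subset_right)
    · refine (M.disjoint_branch_edge hK ?_).mono_right ((hDsub e).trans Set.inter_subset_left)
      rw [hends e, Sym2.mem_iff]
      exact not_or.2 ⟨hu, hut⟩
  refine ⟨fun v => B v ∪ ⋃ e ∈ {e | o e = v}, D e, fun v => ?_, fun u v huv => ?_,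
    fun u v huv => ?_⟩
  · obtain ⟨x, hx⟩ := Set.nonempty_coe_sort.1 (M.connected_branch v).nonempty
    exact SimpleGraph.connected_iff _ |>.2 ⟨preconnected_induce_union_biUnion
      (M.connected_branch v).preconnected (fun e _ => hDconn e) (fun e he => he ▸ hDmeet e),
      x, Or.inl hx⟩
  · simp only [Set.disjoint_union_left, Set.disjoint_union_right, Set.disjoint_iUnion₂_left,
      Set.disjoint_iUnion₂_right]
    refine ⟨⟨M.disjoint_branch hK huv, fun e he => (disjoint_branch_half (he ▸ huv.symm)).symm⟩,
      fun e he => ⟨disjoint_branch_half (he ▸ huv), fun f hf => ?_⟩⟩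
    have hfe : f ≠ e := fun h => huv (hf.symm.trans (h ▸ he))
    exact (M.disjoint_edge hK hfe).mono ((hDsub f).trans Set.inter_subset_left)
      ((hDsub e).trans Set.inter_subset_left)
  · have adj_of_ends : ∀ e, ∃ x ∈ B (o e) ∪ ⋃ f ∈ {f | o f = o e}, D f,
        ∃ y ∈ B (t e) ∪ ⋃ f ∈ {f | o f = t e}, D f, G.Adj x y := fun e => by
      obtain ⟨x, hx, y, hy, hxy⟩ := hDadj e
      exact ⟨x, Or.inr (Set.mem_biUnion (x := e) rfl hx), y, Or.inl hy, hxy⟩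
    obtain ⟨x, hx, y, hy, hxy⟩ := adj_of_ends ⟨s(u, v), huv⟩
    rcases Sym2.eq_iff.1 (hends ⟨s(u, v), huv⟩) with ⟨hu, hv⟩ | ⟨hu, hv⟩
    · exact ⟨x, hu ▸ hx, y, hv ▸ hy, hxy⟩
    · exact ⟨y, hu ▸ hy, x, hv ▸ hx, hxy.symm⟩

end IsFatMinorModel

end Minor

section Subdivision

variable {N E : Type*} {T : SimpleGraph N} {src tgt : E → N} {L : ℕ}

/-- The graph obtained from the graph `T` on `N` by adding, for every `e : E`, a path with `L`
interior vertices from `src e` to `tgt e`. -/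
def addPaths (T : SimpleGraph N) (src tgt : E → N) (L : ℕ) : SimpleGraph (N ⊕ E × Fin L) where
  Adj
    | .inl u, .inl v => T.Adj u v
    | .inl u, .inr (e, i) => (u = src e ∧ (i : ℕ) = 0) ∨ (u = tgt e ∧ (i : ℕ) + 1 = L)
    | .inr (e, i), .inl u => (u = src e ∧ (i : ℕ) = 0) ∨ (u = tgt e ∧ (i : ℕ) + 1 = L)
    | .inr (e, i), .inr (f, j) => e = f ∧ ((i : ℕ) + 1 = j ∨ (j : ℕ) + 1 = i)
  symm := ⟨by
    rintro (u | ⟨e, i⟩) (v | ⟨f, j⟩) h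
    · exact h.symm
    · exact h
    · exact h
    · exact ⟨h.1.symm, h.2.symm⟩⟩
  loopless := ⟨by
    rintro (u | ⟨e, i⟩) h
    · exact T.loopless.irrefl _ h
    · have := h.2; omega⟩

theorem edist_inl_le (u w : N) :
    (addPaths T src tgt L).edist (.inl u) (.inl w) ≤ T.edist u w := by
  let inlHom : T →g addPaths T src tgt L := ⟨Sum.inl, id⟩
  refine le_iInf fun p => ?_
  rw [← p.length_map inlHom]
  exact (p.map inlHom).edist_le

theorem le_setDist_preimage_inl {d : ℕ∞} {X Y : Set (N ⊕ E × Fin L)}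
    (h : d ≤ setDist (addPaths T src tgt L) X Y) :
    d ≤ setDist T (Sum.inl ⁻¹' X) (Sum.inl ⁻¹' Y) :=
  le_setDist_iff.2 fun u hu w hw => (le_setDist_iff.1 h _ hu _ hw).trans (edist_inl_le u w)

/-- The graph on `N` obtained from `addPaths T src tgt L` by contracting every added path to an
edge. -/
def addEdges (T : SimpleGraph N) (src tgt : E → N) : SimpleGraph N :=
  T ⊔ SimpleGraph.fromRel fun u v => ∃ e, src e = u ∧ tgt e = v

theorem addEdges_adj_of_ends {u v : N} (huv : u ≠ v) {e : E}
    (he : src e = u ∧ tgt e = v ∨ src e = v ∧ tgt e = u) : (addEdges T src tgt).Adj u v :=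
  Or.inr ⟨huv, he.imp (fun h => ⟨e, h⟩) fun h => ⟨e, h⟩⟩

theorem preconnected_preimage_inl {R : Set (N ⊕ E × Fin L)}
    (hR : ((addPaths T src tgt L).induce R).Preconnected) :
    ((addEdges T src tgt).induce (Sum.inl ⁻¹' R)).Preconnected := by
  rw [preconnected_induce_iff_forall_subset]
  intro X hX
  have mem_of_ends : ∀ {u v e}, Sum.inl u ∈ R ∧ u ∈ X → Sum.inl v ∈ R →
      (src e = u ∧ tgt e = v ∨ src e = v ∧ tgt e = u) → v ∈ X := by
    intro u v e hu hv he
    by_cases huv : u = v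
    · exact huv ▸ hu.2
    · exact hX u hu v hv (addEdges_adj_of_ends huv he)
  -- A path counts as marked as soon as one of its ends in `R` is.
  let Y : Set (N ⊕ E × Fin L) := {z | match z with
    | .inl v => v ∈ X
    | .inr (e, _) => (Sum.inl (src e) ∈ R ∧ src e ∈ X) ∨ (Sum.inl (tgt e) ∈ R ∧ tgt e ∈ X)}
  have hY : ∀ z ∈ R ∩ Y, ∀ z' ∈ R, (addPaths T src tgt L).Adj z z' → z' ∈ Y := by
    rintro (u | ⟨e, i⟩) ⟨hz, hzY⟩ (v | ⟨f, j⟩) hz' hadj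
    · exact hX u ⟨hz, hzY⟩ v hz' (Or.inl hadj)
    · rcases hadj with ⟨rfl, -⟩ | ⟨rfl, -⟩
      exacts [Or.inl ⟨hz, hzY⟩, Or.inr ⟨hz, hzY⟩]
    · have hv : src e = v ∨ tgt e = v := hadj.imp (fun h => h.1.symm) fun h => h.1.symm
      rcases hv with rfl | rfl
      · exact hzY.elim And.right fun h => mem_of_ends h hz' (Or.inr ⟨rfl, rfl⟩)
      · exact hzY.elim (fun h => mem_of_ends h hz' (Or.inl ⟨rfl, rfl⟩)) And.right
    · obtain ⟨rfl, -⟩ := hadj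
      exact hzY
  rintro ⟨u, hu⟩ v hv
  have hRY := preconnected_induce_iff_forall_subset.1 hR Y hY ⟨.inl u, hu⟩
  exact hRY (a := Sum.inl v) hv

/-- The vertices of the added path `e`, with its ends. -/
def closedPath (src tgt : E → N) (L : ℕ) (e : E) : Set (N ⊕ E × Fin L) :=
  {z | z = .inl (src e) ∨ z = .inl (tgt e) ∨ ∃ i, z = .inr (e, i)}

theorem preconnected_closedPath (hL : 0 < L) (e : E) :
    ((addPaths T src tgt L).induce (closedPath src tgt L e)).Preconnected := by
  rw [preconnected_induce_iff_forall_subset]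
  rintro X hX ⟨x, hx, hxX⟩
  have src_mem_iff : ∀ i (hi : i < L), .inl (src e) ∈ X ↔ .inr (e, ⟨i, hi⟩) ∈ X := by
    intro i
    induction i with
    | zero =>
      intro hi
      exact ⟨fun h => hX _ ⟨Or.inl rfl, h⟩ _ (Or.inr (Or.inr ⟨_, rfl⟩)) (Or.inl ⟨rfl, rfl⟩),
        fun h => hX _ ⟨Or.inr (Or.inr ⟨_, rfl⟩), h⟩ _ (Or.inl rfl) (Or.inl ⟨rfl, rfl⟩)⟩
    | succ i ih =>
      intro hi
      rw [ih (by omega)]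
      exact
        ⟨fun h => hX _ ⟨Or.inr (Or.inr ⟨_, rfl⟩), h⟩ _ (Or.inr (Or.inr ⟨_, rfl⟩)) ⟨rfl, Or.inl rfl⟩,
        fun h => hX _ ⟨Or.inr (Or.inr ⟨_, rfl⟩), h⟩ _ (Or.inr (Or.inr ⟨_, rfl⟩)) ⟨rfl, Or.inr rfl⟩⟩
  have hlast : L - 1 + 1 = L := by omega
  have src_mem_iff_tgt : .inl (src e) ∈ X ↔ .inl (tgt e) ∈ X :=
    (src_mem_iff (L - 1) (by omega)).trans
      ⟨fun h => hX _ ⟨Or.inr (Or.inr ⟨_, rfl⟩), h⟩ _ (Or.inr (Or.inl rfl)) (Or.inr ⟨rfl, hlast⟩),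
      fun h => hX _ ⟨Or.inr (Or.inl rfl), h⟩ _ (Or.inr (Or.inr ⟨_, rfl⟩)) (Or.inr ⟨rfl, hlast⟩)⟩
  have src_mem_iff_mem : ∀ z ∈ closedPath src tgt L e, .inl (src e) ∈ X ↔ z ∈ X := by
    rintro z (rfl | rfl | ⟨i, rfl⟩)
    exacts [Iff.rfl, src_mem_iff_tgt, src_mem_iff i i.2]
  exact fun z hz => (src_mem_iff_mem z hz).1 ((src_mem_iff_mem x hx).2 hxX)

open Classical in
/-- The extension of `g : N → ℕ` to the added paths by the distance to the nearer end, offset by the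
value of `g` there, except that the paths in `S` get the value `0`. -/
noncomputable def extend (src tgt : E → N) (L : ℕ) (S : Set E) (g : N → ℕ) : N ⊕ E × Fin L → ℕ
  | .inl u => g u
  | .inr (e, i) => if e ∈ S then 0 else min (g (src e) + (i + 1)) (g (tgt e) + (L - i))

theorem extend_le_extend_add_one {S : Set E} {g : N → ℕ} (hg : ∀ u, g u ≤ L)
    (hT : ∀ u v, T.Adj u v → g u ≤ g v + 1)
    (hS : ∀ e ∈ S, g (src e) = 0 ∧ g (tgt e) = 0) (z z' : N ⊕ E × Fin L)
    (h : (addPaths T src tgt L).Adj z z') :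
    extend src tgt L S g z ≤ extend src tgt L S g z' + 1 := by
  rcases z with u | ⟨e, i⟩ <;> rcases z' with v | ⟨f, j⟩
  · exact hT u v h
  · have hsrc := hg (src f)
    have htgt := hg (tgt f)
    have hu := hg u
    simp only [extend]
    split_ifs with hf
    · have := hS f hf
      rcases h with ⟨rfl, -⟩ | ⟨rfl, -⟩ <;> omega
    · rcases h with ⟨rfl, h⟩ | ⟨rfl, h⟩ <;> omega
  · have := hg (src e)
    have := hg (tgt e)
    simp only [extend]
    split_ifs with hf
    · omega
    · rcases h with ⟨rfl, h⟩ | ⟨rfl, h⟩ <;> omega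
  · obtain ⟨rfl, h⟩ := h
    simp only [extend]
    split_ifs <;> omega

end Subdivision

section CliqueModel

variable {ι V : Type*} {G : SimpleGraph V} {B : ι → Set V} {P : Sym2 ι → Set V} {X X₁ X₂ : Set V}

theorem card_le_card_of_forall_inter_nonempty {I : Finset ι} {Z : Finset V} {F : ι → Set V}
    (hF : (I : Set ι).PairwiseDisjoint F) (hZ : ∀ i ∈ I, (F i ∩ Z).Nonempty) :
    I.card ≤ Z.card := by
  have exists_mem : ∀ i : I, ∃ z, z ∈ F i ∩ Z := fun i => hZ i i.2
  choose f hf using exists_mem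
  rw [← Finset.card_attach]
  refine Finset.card_le_card_of_injOn f (fun i _ => (hf i).2) fun i _ j _ hij => ?_
  by_contra hne
  exact Set.disjoint_left.1 (hF i.2 j.2 fun h => hne (Subtype.ext h)) (hf i).1 (hij ▸ (hf j).1)

/-- A model of the complete graph on `ι` in which the branch sets `B i` and the sets `P s(i, j)` are
pairwise disjoint. Only the unions `B i ∪ P s(i, j) ∪ B j` are required to be connected, a property
that is inherited when such a model is restricted to the nodes of a subdivided graph. -/
structure IsCliqueModel (G : SimpleGraph V) (B : ι → Set V) (P : Sym2 ι → Set V) : Prop where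
  nonempty : ∀ i, (B i).Nonempty
  preconnected_branch : ∀ i, (G.induce (B i)).Preconnected
  preconnected_join : ∀ i j, i ≠ j → (G.induce (B i ∪ P s(i, j) ∪ B j)).Preconnected
  disjoint_branch : Pairwise (Function.onFun Disjoint B)
  disjoint_edge : Pairwise (Function.onFun Disjoint P)
  disjoint_branch_edge : ∀ i e, Disjoint (B i) (P e)

/-- The set `X` contains no branch set. -/
def Small (B : ι → Set V) (X : Set V) : Prop := ∀ i, ¬ B i ⊆ X

namespace IsCliqueModel

theorem small_empty (M : IsCliqueModel G B P) : Small B ∅ := fun i hi =>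
  (M.nonempty i).ne_empty (Set.subset_empty_iff.1 hi)

theorem exists_inter_bridge_nonempty (M : IsCliqueModel G B P) {Z : Set V}
    (hX : ∀ u ∈ X, ∀ w, G.Adj u w → w ∈ X ∨ w ∈ Z) {i j k : ι} (hi : B i ⊆ X)
    (hjX : Disjoint (B j) X) (hjZ : Disjoint (B j) Z) (hki : k ≠ i) (hkj : k ≠ j) :
    ((P s(i, k) ∪ B k ∪ P s(k, j)) ∩ Z).Nonempty := by
  obtain ⟨xi, hxi⟩ := M.nonempty i
  obtain ⟨xj, hxj⟩ := M.nonempty j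
  obtain ⟨xk, hxk⟩ := M.nonempty k
  have hR := SimpleGraph.induce_union_connected (M.preconnected_join i k hki.symm)
    (M.preconnected_join k j hkj)
    ⟨xk, Or.inr hxk, Or.inl (Or.inl hxk)⟩
  obtain ⟨u, hu, w, ⟨hwR, hwX⟩, huw⟩ := exists_adj_of_preconnected hR.preconnected
    ⟨Or.inl (Or.inl (Or.inl hxi)), hi hxi⟩ ⟨Or.inr (Or.inr hxj), hjX.notMem_of_mem_left hxj⟩
  have hwZ : w ∈ Z := (hX u hu.2 w huw).resolve_left hwX
  have hwi : w ∉ B i := fun h => hwX (hi h)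
  have hwj : w ∉ B j := fun h => hjZ.notMem_of_mem_left h hwZ
  refine ⟨w, ?_, hwZ⟩
  simp only [Set.mem_union] at hwR ⊢
  tauto

theorem pairwiseDisjoint_bridge (M : IsCliqueModel G B P) {i j : ι} (hij : i ≠ j) :
    {k | k ≠ i ∧ k ≠ j}.PairwiseDisjoint fun k => P s(i, k) ∪ B k ∪ P s(k, j) := by
  rintro k ⟨hki, hkj⟩ l ⟨_, _⟩ hkl
  have hP : ∀ {e f}, e ≠ f → Disjoint (P e) (P f) := fun h => M.disjoint_edge h
  simp only [Function.onFun, Set.disjoint_union_left, Set.disjoint_union_right]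
  refine ⟨⟨⟨⟨hP ?_, M.disjoint_branch_edge _ _⟩, hP ?_⟩,
    ⟨(M.disjoint_branch_edge _ _).symm, M.disjoint_branch hkl⟩, (M.disjoint_branch_edge _ _).symm⟩,
    ⟨hP ?_, M.disjoint_branch_edge _ _⟩, hP ?_⟩ <;> simp only [ne_eq, Sym2.eq_iff] <;> tauto

variable [Fintype ι]

theorem exists_disjoint (M : IsCliqueModel G B P) {Z : Finset V} (hZ : Z.card < Fintype.card ι) :
    ∃ i, Disjoint (B i) (Z : Set V) := by
  by_contra! h
  exact hZ.not_ge (card_le_card_of_forall_inter_nonempty (I := Finset.univ)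
    (fun i _ j _ hij => M.disjoint_branch hij)
    fun i _ => Set.not_disjoint_iff_nonempty_inter.1 (h i))

theorem not_separated (M : IsCliqueModel G B P) {Z : Finset V} (hZ : Z.card + 2 < Fintype.card ι)
    (hX : ∀ u ∈ X, ∀ w, G.Adj u w → w ∈ X ∨ w ∈ Z) {i j : ι} (hi : B i ⊆ X)
    (hjX : Disjoint (B j) X) (hjZ : Disjoint (B j) (Z : Set V)) : False := by
  classical
  obtain ⟨x, hx⟩ := M.nonempty i
  have hij : i ≠ j := fun h => hjX.notMem_of_mem_left (h ▸ hx) (hi hx)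
  have mem_iff : ∀ {k}, k ∈ ({i, j} : Finset ι)ᶜ ↔ k ≠ i ∧ k ≠ j := by simp
  have hle : ({i, j} : Finset ι)ᶜ.card ≤ Z.card := card_le_card_of_forall_inter_nonempty
    ((M.pairwiseDisjoint_bridge hij).subset fun k hk => mem_iff.1 hk) fun k hk =>
      M.exists_inter_bridge_nonempty hX hi hjX hjZ (mem_iff.1 hk).1 (mem_iff.1 hk).2
  rw [Finset.card_compl, Finset.card_pair hij] at hle
  omega

theorem small_of_cut (M : IsCliqueModel G B P) {Z₀ Z : Finset V} (hZZ : Z₀ ⊆ Z)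
    (hZ₀ : Z₀.card + 2 < Fintype.card ι) (hZ : Z.card < Fintype.card ι)
    (hX : ∀ u ∈ X, ∀ w, G.Adj u w → w ∈ X ∨ w ∈ Z₀)
    (hcover : X ⊆ Z ∪ (X₁ ∪ X₂)) (hadj : ∀ u ∈ X₁, ∀ w ∈ X₂, ¬ G.Adj u w)
    (h₁ : Small B X₁) (h₂ : Small B X₂) : Small B X := by
  intro i hi
  obtain ⟨j, hj⟩ := M.exists_disjoint hZ
  have hj₀ : Disjoint (B j) (Z₀ : Set V) := hj.mono_right (Finset.coe_subset.2 hZZ)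
  have hjX : B j ⊆ X :=
    (subset_or_disjoint_of_preconnected (M.preconnected_branch j) fun u hu w hw huw =>
      (hX u hu.2 w huw).resolve_right (hj₀.notMem_of_mem_left hw)).resolve_right
      fun h => M.not_separated hZ₀ hX hi h hj₀
  have hj₁₂ : B j ⊆ X₁ ∪ X₂ := fun u hu => (hcover (hjX hu)).resolve_left (hj.notMem_of_mem_left hu)
  rcases subset_or_disjoint_of_preconnected (M.preconnected_branch j) (X := X₁)
    fun u hu w hw huw => (hj₁₂ hw).resolve_right fun h => hadj u hu.2 w h huw with h | h
  · exact h₁ j h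
  · exact h₂ j fun u hu => (hj₁₂ hu).resolve_left (h.notMem_of_mem_left hu)

section Subdivision

variable {N E : Type*} {T : SimpleGraph N} {src tgt : E → N} {L : ℕ}
  {B : ι → Set (N ⊕ E × Fin L)} {P : Sym2 ι → Set (N ⊕ E × Fin L)}

theorem small_initial_segment (M : IsCliqueModel (addPaths T src tgt L) B P)
    (hι : 4 < Fintype.card ι) (e : E) {m : ℕ} (hm : m ≤ L) :
    Small B {z | ∃ i : Fin L, z = .inr (e, i) ∧ (i : ℕ) < m} := by
  classical
  induction m with
  | zero => simpa using M.small_empty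
  | succ m ih =>
    let next : N ⊕ E × Fin L := if h : m + 1 < L then .inr (e, ⟨m + 1, h⟩) else .inl (tgt e)
    refine M.small_of_cut (X₂ := ∅)
      (Z₀ := {.inl (src e), next}) (Z := {.inl (src e), next, .inr (e, ⟨m, by omega⟩)})
      (by grind) (Nat.lt_of_le_of_lt (Nat.add_le_add_right Finset.card_le_two 2) hι)
      (Finset.card_le_three.trans_lt (by omega)) ?_ ?_ (by simp) (ih (by omega)) M.small_empty
    · rintro _ ⟨i, rfl, hi⟩ (w | ⟨f, j⟩) hadj
      · right
        rcases hadj with ⟨rfl, -⟩ | ⟨rfl, h⟩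
        · simp
        · simp [next, show ¬ m + 1 < L by omega]
      · obtain ⟨rfl, h⟩ := hadj
        by_cases hj : (j : ℕ) < m + 1
        · exact Or.inl ⟨j, rfl, hj⟩
        · have hjm : (j : ℕ) = m + 1 := by omega
          simp [next, ← hjm]
    · rintro _ ⟨i, rfl, hi⟩
      rcases Nat.lt_succ_iff_lt_or_eq.1 hi with h | rfl
      · exact Or.inr (Or.inl ⟨i, rfl, h⟩)
      · simp

theorem preimage_inl (M : IsCliqueModel (addPaths T src tgt L) B P) (hι : 4 < Fintype.card ι) :
    IsCliqueModel (addEdges T src tgt) (fun i => Sum.inl ⁻¹' B i) (fun e => Sum.inl ⁻¹' P e) where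
  nonempty i := by
    by_contra hn
    have not_mem : ∀ u, Sum.inl u ∉ B i := fun u hu => hn ⟨u, hu⟩
    obtain ⟨x | ⟨e, k⟩, hx⟩ := M.nonempty i
    · exact not_mem x hx
    · refine M.small_initial_segment hι e le_rfl i (preconnected_induce_iff_forall_subset.1
        (M.preconnected_branch i) _ ?_ ⟨_, hx, k, rfl, k.2⟩)
      rintro _ ⟨-, l, rfl, -⟩ (w | ⟨f, j⟩) hw hadj
      · exact absurd hw (not_mem w)
      · obtain ⟨rfl, -⟩ := hadj
        exact ⟨j, rfl, j.2⟩
  preconnected_branch i := preconnected_preimage_inl (M.preconnected_branch i)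
  preconnected_join i j hij := preconnected_preimage_inl (M.preconnected_join i j hij)
  disjoint_branch _ _ hij := (M.disjoint_branch hij).preimage _
  disjoint_edge _ _ hef := (M.disjoint_edge hef).preimage _
  disjoint_branch_edge i e := (M.disjoint_branch_edge i e).preimage _

end Subdivision

end IsCliqueModel

end CliqueModel

section Construction

variable {n : ℕ}

/-- The nodes of the construction: a binary tree of depth `n`, where `tree 1` is the root, `tree 0`
an additional node above it, and `tree (k / 2)` the parent of `tree k`; a row of nodes, one below
each leaf; and for both cliques `s` the vertices `hub s i` and a node `port s i j` next to `hub s i`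
on the connection of `hub s i` with `hub s j`. -/
inductive Node (n : ℕ)
  | tree (k : Fin (2 ^ (n + 1)))
  | row (i : Fin (2 ^ n))
  | hub (s : Bool) (i : Fin 15)
  | port (s : Bool) (i j : Fin 15)
  deriving DecidableEq, Fintype

/-- The connections of the construction that are subdivided into long paths. -/
inductive LongEdge (n : ℕ)
  | rowRow (i : Fin (2 ^ n - 1))
  | leafRow (i : Fin (2 ^ n - 1))
  | rowLeaf (i : Fin (2 ^ n - 1))
  | hubPort (s : Bool) (i j : Fin 15)
  | portPort (s : Bool) (i j : Fin 15)
  | attach (s : Bool) (c : Fin 3)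
  deriving DecidableEq, Fintype

/-- The additional node above the root of the tree. -/
def Node.apex : Node n := .tree ⟨0, by positivity⟩

/-- The leaf of the tree in column `i`. -/
def Node.leaf (i : Fin (2 ^ n)) : Node n := .tree ⟨2 ^ n + i, by rw [pow_succ]; omega⟩

/-- The `i`-th column, consisting of a leaf and the row node below it. -/
def column (i : Fin (2 ^ n)) : Set (Node n) := {.leaf i, .row i}

/-- The left one of the two columns joined by the `i`-th edges of each type. -/
def colL (i : Fin (2 ^ n - 1)) : Fin (2 ^ n) := ⟨i, by omega⟩

/-- The right one of the two columns joined by the `i`-th edges of each type. -/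
def colR (i : Fin (2 ^ n - 1)) : Fin (2 ^ n) := ⟨i + 1, by omega⟩

/-- The column where clique `s` is attached. -/
def endCol (s : Bool) : Fin (2 ^ n) :=
  if s then ⟨2 ^ n - 1, Nat.sub_lt (by positivity) one_pos⟩ else ⟨0, by positivity⟩

/-- The node to which vertex `c` of clique `s` is attached. -/
def terminal (s : Bool) (c : Fin 3) : Node n :=
  if c = 0 then .leaf (endCol s) else if c = 1 then .row (endCol s) else .apex

/-- The first end of a long edge. -/
def LongEdge.src : LongEdge n → Node n
  | .rowRow i => .row (colL i)
  | .leafRow i => .leaf (colL i)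
  | .rowLeaf i => .row (colL i)
  | .hubPort s i _ => .hub s i
  | .portPort s i j => .port s i j
  | .attach s c => .hub s (Fin.castLE (by norm_num) c)

/-- The second end of a long edge. -/
def LongEdge.tgt : LongEdge n → Node n
  | .rowRow i => .row (colR i)
  | .leafRow i => .row (colR i)
  | .rowLeaf i => .leaf (colR i)
  | .hubPort s i j => .port s i j
  | .portPort s i j => .port s j i
  | .attach s c => terminal s c

/-- The binary tree on the nodes `tree k`; all other nodes are isolated. -/
def tree (n : ℕ) : SimpleGraph (Node n) where
  Adj
    | .tree u, .tree v => u ≠ v ∧ ((u : ℕ) = v / 2 ∨ (v : ℕ) = u / 2)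
    | _, _ => False
  symm := ⟨by
    rintro (u | u | _ | _) (v | v | _ | _) h <;> try exact h
    exact ⟨h.1.symm, h.2.symm⟩⟩
  loopless := ⟨by
    rintro (u | u | _ | _) h <;> try exact h
    exact h.1 rfl⟩

/-- The graph of the main theorem, for a suitable length `L` of the long paths. -/
def fatGraph (n L : ℕ) : SimpleGraph (Node n ⊕ LongEdge n × Fin L) :=
  addPaths (tree n) LongEdge.src LongEdge.tgt L

/-- The graph `fatGraph n L` with every long path replaced by an edge. -/
def nodeGraph (n : ℕ) : SimpleGraph (Node n) := addEdges (tree n) LongEdge.src LongEdge.tgt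

/-- The kinds of edges of `nodeGraph n`, up to orientation. Between two consecutive columns this is
only an upper bound, as the edge between their leaves is absent from `nodeGraph n`. -/
inductive NodeLink : Node n → Node n → Prop
  | parent {j k : Fin (2 ^ (n + 1))} (h : (j : ℕ) = k / 2) : NodeLink (.tree j) (.tree k)
  | column {i j : Fin (2 ^ n)} {u w : Node n} (h : (i : ℕ) + 1 = j) (hu : u ∈ column i)
      (hw : w ∈ column j) : NodeLink u w
  | hubApex (s : Bool) : NodeLink (.hub s 2) .apex
  | hubColumn (s : Bool) {i : Fin 15} {u : Node n} (hi : (i : ℕ) < 3) (hu : u ∈ column (endCol s)) :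
      NodeLink (.hub s i) u
  | hubPort (s : Bool) (i j : Fin 15) : NodeLink (.hub s i) (.port s i j)
  | portPort (s : Bool) (i j : Fin 15) : NodeLink (.port s i j) (.port s j i)

theorem leaf_mem_column (i : Fin (2 ^ n)) : Node.leaf i ∈ column i := Or.inl rfl

theorem row_mem_column (i : Fin (2 ^ n)) : Node.row i ∈ column i := Or.inr rfl

theorem nodeLink_src_tgt (e : LongEdge n) : NodeLink e.src e.tgt := by
  rcases e with i | i | i | ⟨s, i, j⟩ | ⟨s, i, j⟩ | ⟨s, c⟩
  · exact .column rfl (row_mem_column _) (row_mem_column _)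
  · exact .column rfl (leaf_mem_column _) (row_mem_column _)
  · exact .column rfl (row_mem_column _) (leaf_mem_column _)
  · exact .hubPort s i j
  · exact .portPort s i j
  · fin_cases c
    · exact .hubColumn s (by norm_num) (leaf_mem_column _)
    · exact .hubColumn s (by norm_num) (row_mem_column _)
    · exact .hubApex s

theorem nodeLink_of_adj {u w : Node n} (h : (nodeGraph n).Adj u w) :
    NodeLink u w ∨ NodeLink w u := by
  rcases h with h | ⟨-, ⟨e, rfl, rfl⟩ | ⟨e, rfl, rfl⟩⟩
  · rcases u with u | u | _ | _ <;> rcases w with w | w | _ | _ <;> try exact h.elim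
    exact h.2.imp .parent .parent
  · exact Or.inl (nodeLink_src_tgt e)
  · exact Or.inr (nodeLink_src_tgt e)

theorem not_adj_leaf_leaf (i j : Fin (2 ^ n)) : ¬ (nodeGraph n).Adj (.leaf i) (.leaf j) := by
  have no_edge : ∀ (e : LongEdge n) (i j : Fin (2 ^ n)), ¬ (e.src = .leaf i ∧ e.tgt = .leaf j) := by
    rintro (_ | _ | _ | _ | _ | _) i j ⟨hi, hj⟩ <;> first | cases hi | cases hj
  rintro (⟨-, h⟩ | ⟨-, ⟨e, he⟩ | ⟨e, he⟩⟩)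
  · simp only at h
    omega
  · exact no_edge e i j he
  · exact no_edge e j i he

end Construction

section Blocks

variable {n h k : ℕ} {a b c d i : Fin (2 ^ n)} {u w : Node n}

/-- The nodes of the subtree of height `h` below `tree k`, with the row nodes in its columns. -/
def block (n h k : ℕ) : Set (Node n) := {u | match u with
  | .tree j => ∃ m ≤ h, (j : ℕ) / 2 ^ m = k
  | .row i => (2 ^ n + (i : ℕ)) / 2 ^ h = k
  | _ => False}

/-- The subtree of height `h` below `tree k` reaches down to the leaves, from column `a` to
column `b`. -/
structure Spans (h k : ℕ) (a b : Fin (2 ^ n)) : Prop where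
  first : k * 2 ^ h = 2 ^ n + a
  last : (k + 1) * 2 ^ h = 2 ^ n + b + 1

theorem spans_root : Spans n 1 (endCol (n := n) false) (endCol true) where
  first := by simp [endCol]
  last := by
    have : 0 < 2 ^ n := by positivity
    simp only [endCol, if_true]
    omega

theorem div_pow_eq_iff {j d k : ℕ} : j / 2 ^ d = k ↔ k * 2 ^ d ≤ j ∧ j < (k + 1) * 2 ^ d := by
  have : 0 < 2 ^ d := by positivity
  rw [Nat.div_eq_iff this, add_mul, one_mul]
  omega

theorem le_of_tree_mem_block {j : Fin (2 ^ (n + 1))} (hj : Node.tree j ∈ block n h k) : k ≤ j := by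
  obtain ⟨m, -, rfl⟩ := hj
  exact Nat.div_le_self _ _

theorem mem_block_of_mem_block_succ (hu : u ∈ block n (h + 1) k) :
    (∃ j : Fin (2 ^ (n + 1)), u = .tree j ∧ (j : ℕ) = k) ∨
      u ∈ block n h (2 * k) ∪ block n h (2 * k + 1) := by
  have half_cases : ∀ {j m : ℕ}, j / 2 ^ (m + 1) = k →
      j / 2 ^ m = 2 * k ∨ j / 2 ^ m = 2 * k + 1 := by
    intro j m hj
    rw [pow_succ, ← Nat.div_div_eq_div_mul] at hj
    omega
  rcases u with j | i | _ | _
  · obtain ⟨_ | m, hm, hj⟩ := hu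
    · exact Or.inl ⟨j, rfl, by simpa using hj⟩
    · have hm : m ≤ h := by omega
      exact Or.inr ((half_cases hj).imp (fun hj => ⟨m, hm, hj⟩) fun hj => ⟨m, hm, hj⟩)
  · exact Or.inr (half_cases hu)
  · exact hu.elim
  · exact hu.elim

theorem parent_mem_block {j j' : Fin (2 ^ (n + 1))} (hj : Node.tree j ∈ block n h k)
    (hjk : (j : ℕ) ≠ k) (hj' : (j' : ℕ) = j / 2) : Node.tree j' ∈ block n h k := by
  obtain ⟨_ | m, hm, hm'⟩ := hj
  · simp at hm'
    omega
  · refine ⟨m, by omega, ?_⟩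
    rwa [hj', Nat.div_div_eq_div_mul, mul_comm, ← pow_succ]

theorem disjoint_block (hk : 0 < k) : Disjoint (block n h (2 * k)) (block n h (2 * k + 1)) := by
  rw [Set.disjoint_left]
  rintro (j | i | _ | _) hu hw
  · obtain ⟨l, -, hl⟩ := hu
    obtain ⟨m, -, hm⟩ := hw
    have div_le : ∀ {r : ℕ}, 0 < r → ∀ i, i / 2 ^ r ≤ i / 2 := fun hr i =>
      Nat.div_le_div_left (Nat.le_self_pow hr.ne' 2) two_pos
    have hdiv : ∀ {l m : ℕ} (_ : l < m), (j : ℕ) / 2 ^ m = j / 2 ^ l / 2 ^ (m - l) := by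
      intro l m hlm
      rw [Nat.div_div_eq_div_mul, ← pow_add, Nat.add_sub_cancel' hlm.le]
    rcases lt_trichotomy l m with hlm | rfl | hlm
    · have := div_le (Nat.sub_pos_of_lt hlm) (2 * k)
      rw [hdiv hlm, hl] at hm
      omega
    · omega
    · have := div_le (Nat.sub_pos_of_lt hlm) (2 * k + 1)
      rw [hdiv hlm, hm] at hl
      omega
  · have hu : (2 ^ n + (i : ℕ)) / 2 ^ h = 2 * k := hu
    have hw : (2 ^ n + (i : ℕ)) / 2 ^ h = 2 * k + 1 := hw
    omega
  · exact hu
  · exact hu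

namespace Spans

theorem pos (S : Spans h k a b) : 0 < k := by
  have := S.first
  have : 0 < 2 ^ n := by positivity
  exact Nat.pos_of_ne_zero fun hk => by simp [hk] at *; omega

theorem lt (S : Spans h k a b) : k < 2 ^ (n + 1) := by
  have := S.last
  have : k + 1 ≤ (k + 1) * 2 ^ h := Nat.le_mul_of_pos_right _ (by positivity)
  rw [pow_succ]
  omega

theorem le (S : Spans h k a b) : a ≤ b := by
  obtain ⟨ha, hb⟩ := S
  have : 0 < 2 ^ h := by positivity
  rw [add_mul, ha] at hb
  omega

/-- The root of the subtree. -/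
def top (S : Spans h k a b) : Node n := .tree ⟨k, S.lt⟩

theorem exists_halves (S : Spans (h + 1) k a b) :
    ∃ c d : Fin (2 ^ n), (c : ℕ) + 1 = d ∧ Spans h (2 * k) a c ∧ Spans h (2 * k + 1) d b := by
  obtain ⟨ha, hb⟩ := S
  have hh : 0 < 2 ^ h := by positivity
  have ha' : 2 * k * 2 ^ h = 2 ^ n + a := by rw [← ha]; ring
  have hb' : (2 * k + 1 + 1) * 2 ^ h = 2 ^ n + b + 1 := by rw [← hb]; ring
  have hm : (2 * k + 1) * 2 ^ h = 2 * k * 2 ^ h + 2 ^ h := by ring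
  have hm' : (2 * k + 1 + 1) * 2 ^ h = (2 * k + 1) * 2 ^ h + 2 ^ h := by ring
  exact ⟨⟨a + 2 ^ h - 1, by omega⟩, ⟨a + 2 ^ h, by omega⟩, by simp only; omega,
    ⟨ha', by simp only; omega⟩, ⟨by simp only; omega, hb'⟩⟩

theorem mem_block_iff (S : Spans h k a b) (hu : u ∈ column i) :
    u ∈ block n h k ↔ a ≤ i ∧ i ≤ b := by
  have hrow : Node.row i ∈ block n h k ↔ a ≤ i ∧ i ≤ b := by
    have hab := div_pow_eq_iff (j := 2 ^ n + i) (d := h) (k := k)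
    rw [S.first, S.last] at hab
    exact hab.trans (by omega)
  rcases hu with rfl | rfl
  · refine Iff.trans ⟨?_, fun hi => ⟨h, le_rfl, hi⟩⟩ hrow
    rintro ⟨m, hm, hmk⟩
    obtain rfl : m = h := by
      by_contra hne
      have h1 := (div_pow_eq_iff.1 hmk).2
      have h2 : (k + 1) * 2 ^ (m + 1) ≤ (k + 1) * 2 ^ h :=
        Nat.mul_le_mul_left _ (Nat.pow_le_pow_right two_pos (by omega))
      have := S.last
      rw [pow_succ, ← mul_assoc] at h2
      simp only at h1
      omega
    exact hmk
  · exact hrow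

theorem column_subset (S : Spans h k a b) (ha : a ≤ i) (hb : i ≤ b) : column i ⊆ block n h k :=
  fun _ hu => (S.mem_block_iff hu).2 ⟨ha, hb⟩

theorem child_mem_block (S : Spans h k a b) {j j' : Fin (2 ^ (n + 1))}
    (hj : Node.tree j ∈ block n h k) (hj' : (j : ℕ) = j' / 2) : Node.tree j' ∈ block n h k := by
  obtain ⟨m, hm, hmk⟩ := hj
  rcases hm.lt_or_eq with hlt | rfl
  · refine ⟨m + 1, hlt, ?_⟩
    have := Nat.div_div_eq_div_mul j' 2 (2 ^ m)
    rwa [← pow_succ', ← hj', hmk, eq_comm] at this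
  · have h1 := (div_pow_eq_iff.1 hmk).1
    have h2 : (j' : ℕ) < 2 ^ n * 2 := pow_succ 2 n ▸ j'.2
    rw [S.first] at h1
    omega

theorem eq_top_or_mem_column_of_adj (S : Spans h k a b) (hu : u ∈ block n h k)
    (hw : w ∉ block n h k) (huw : (nodeGraph n).Adj u w) :
    u = S.top ∨ u ∈ column a ∨ u ∈ column b := by
  rcases nodeLink_of_adj huw with huw | huw
  · cases huw with
    | parent hj => exact absurd (S.child_mem_block hu hj) hw
    | @column i _ _ _ hij hui hwj =>
      rw [S.mem_block_iff hui] at hu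
      rw [S.mem_block_iff hwj] at hw
      exact Or.inr (Or.inr ((show i = b by omega) ▸ hui))
    | _ => exact hu.elim
  · cases huw with
    | @parent _ j hj =>
      by_cases hjk : (j : ℕ) = k
      · exact Or.inl (congrArg Node.tree (Fin.ext hjk))
      · exact absurd (parent_mem_block hu hjk hj) hw
    | @column _ j _ _ hij hwi huj =>
      rw [S.mem_block_iff huj] at hu
      rw [S.mem_block_iff hwi] at hw
      exact Or.inr (Or.inl ((show j = a by omega) ▸ huj))
    | hubApex s => exact absurd (le_of_tree_mem_block hu) S.pos.not_ge
    | hubColumn s _ hus =>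
      have hmem := (S.mem_block_iff hus).1 hu
      cases s
      · have : a = endCol false := le_antisymm hmem.1 (Nat.zero_le _)
        exact Or.inr (Or.inl (this ▸ hus))
      · have : b = endCol true := le_antisymm (Nat.le_sub_one_of_lt b.2) hmem.2
        exact Or.inr (Or.inr (this ▸ hus))
    | _ => exact hu.elim

end Spans

/-- The set `V` consists of `t` and two parts `U` and `U'` such that all edges between these three
are the ones from `t` to `t₁ ∈ U` and to `t₂ ∈ U'` and edges between column `c` of `U` and column
`d` of `U'`. Columns `a` and `b` are further columns of `U` and `U'`. -/
structure IsJoin (V U U' : Set (Node n)) (t t₁ t₂ : Node n) (a c d b : Fin (2 ^ n)) : Prop where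
  subset : V ⊆ insert t (U ∪ U')
  disjoint : Disjoint U U'
  notMem_left : t ∉ U
  notMem_right : t ∉ U'
  adj_left : (tree n).Adj t₁ t
  adj_right : (tree n).Adj t₂ t
  eq_of_adj_left : ∀ u ∈ U, (nodeGraph n).Adj u t → u = t₁
  eq_of_adj_right : ∀ u ∈ U', (nodeGraph n).Adj u t → u = t₂
  mem_column_of_adj : ∀ u ∈ U, ∀ w ∈ U', (nodeGraph n).Adj u w → u ∈ column c ∧ w ∈ column d
  outer_left : column a ⊆ U
  inner_left : column c ⊆ U
  inner_right : column d ⊆ U'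
  outer_right : column b ⊆ U'

theorem IsJoin.symm {V U U' : Set (Node n)} {t t₁ t₂ : Node n} (J : IsJoin V U U' t t₁ t₂ a c d b) :
    IsJoin V U' U t t₂ t₁ b d c a where
  subset := by rw [Set.union_comm]; exact J.subset
  disjoint := J.disjoint.symm
  notMem_left := J.notMem_right
  notMem_right := J.notMem_left
  adj_left := J.adj_right
  adj_right := J.adj_left
  eq_of_adj_left := J.eq_of_adj_right
  eq_of_adj_right := J.eq_of_adj_left
  mem_column_of_adj u hu w hw huw := (J.mem_column_of_adj w hw u hu huw.symm).symm
  outer_left := J.outer_right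
  inner_left := J.inner_right
  inner_right := J.inner_left
  outer_right := J.outer_left

namespace Spans

theorem top_notMem_column (S : Spans (h + 1) k a b) (i : Fin (2 ^ n)) : S.top ∉ column i := by
  have hb := S.last
  have : (k + 1) * 2 ≤ (k + 1) * 2 ^ (h + 1) :=
    Nat.mul_le_mul_left _ (Nat.le_self_pow h.succ_ne_zero 2)
  rintro (ht | ht)
  · have ht : k = 2 ^ n + i := by simpa [top, Node.leaf] using ht
    omega
  · cases ht

theorem eq_top_of_adj (S : Spans (h + 1) k a b) {k' : ℕ} {i j : Fin (2 ^ n)} (S' : Spans h k' i j)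
    (hk' : k' = 2 * k ∨ k' = 2 * k + 1) (hu : u ∈ block n h k') (hut : (nodeGraph n).Adj u S.top) :
    u = S'.top := by
  have hk : k < k' := by have := S.pos; omega
  rw [top] at hut
  rcases nodeLink_of_adj hut with hut | hut
  · cases hut with
    | parent hj => exact absurd (le_of_tree_mem_block hu) (by simp only at hj; omega)
    | column _ _ ht => exact absurd ht (S.top_notMem_column _)
    | _ => exact hu.elim
  · cases hut with
    | @parent _ j hj =>
      by_cases hjk : (j : ℕ) = k'
      · exact congrArg Node.tree (Fin.ext hjk)
      · exact absurd (le_of_tree_mem_block (parent_mem_block hu hjk hj)) hk.not_ge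
    | column _ ht _ => exact absurd ht (S.top_notMem_column _)

theorem mem_column_of_adj (S₁ : Spans h (2 * k) a c) (S₂ : Spans h (2 * k + 1) d b)
    (hcd : (c : ℕ) + 1 = d) (hu : u ∈ block n h (2 * k)) (hw : w ∈ block n h (2 * k + 1))
    (huw : (nodeGraph n).Adj u w) : u ∈ column c ∧ w ∈ column d := by
  have hk := S₁.pos
  have hdisj := Set.disjoint_left.1 (disjoint_block (n := n) (h := h) (k := k) (by omega))
  rcases nodeLink_of_adj huw with huw | huw
  · cases huw with
    | parent hj => exact absurd (S₁.child_mem_block hu hj) (fun h => hdisj h hw)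
    | @column i j _ _ hij hui hwj =>
      have hi := (S₁.mem_block_iff hui).1 hu
      have hj := (S₂.mem_block_iff hwj).1 hw
      exact ⟨(show i = c by omega) ▸ hui, (show j = d by omega) ▸ hwj⟩
    | _ => exact hu.elim
  · cases huw with
    | parent hj => exact absurd (S₂.child_mem_block hw hj) (hdisj hu)
    | column hij hwi huj =>
      have hi := (S₂.mem_block_iff hwi).1 hw
      have hj := (S₁.mem_block_iff huj).1 hu
      omega
    | _ => exact hw.elim

theorem isJoin (S : Spans (h + 1) k a b) (S₁ : Spans h (2 * k) a c) (S₂ : Spans h (2 * k + 1) d b)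
    (hcd : (c : ℕ) + 1 = d) :
    IsJoin (block n (h + 1) k) (block n h (2 * k)) (block n h (2 * k + 1)) S.top S₁.top S₂.top
      a c d b where
  subset u hu := (mem_block_of_mem_block_succ hu).imp
    (fun ⟨_, hu, hj⟩ => hu.trans (congrArg Node.tree (Fin.ext hj))) id
  disjoint := disjoint_block S.pos
  notMem_left ht := absurd (le_of_tree_mem_block ht) (by have := S.pos; simp only; omega)
  notMem_right ht := absurd (le_of_tree_mem_block ht) (by have := S.pos; simp only; omega)
  adj_left := ⟨fun he => by have := S.pos; simp at he; omega, Or.inr (by simp)⟩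
  adj_right := ⟨fun he => by have := S.pos; simp at he; omega, Or.inr (by simp only; omega)⟩
  eq_of_adj_left _ hu huw := S.eq_top_of_adj S₁ (Or.inl rfl) hu huw
  eq_of_adj_right _ hu huw := S.eq_top_of_adj S₂ (Or.inr rfl) hu huw
  mem_column_of_adj _ hu _ hw huw := S₁.mem_column_of_adj S₂ hcd hu hw huw
  outer_left := S₁.column_subset le_rfl S₁.le
  inner_left := S₁.column_subset S₁.le le_rfl
  inner_right := S₂.column_subset le_rfl S₂.le
  outer_right := S₂.column_subset S₂.le le_rfl

end Spans

end Blocks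

section Coloring

variable {n : ℕ} {U U' V R B : Set (Node n)} {t t₁ t₂ u w : Node n} {a b c d : Fin (2 ^ n)}

/-- Two connected subsets of `U`, thought of as a red and a blue one, at distance at least `3` in
the tree. -/
structure FarPair (U R B : Set (Node n)) : Prop where
  subset_left : R ⊆ U
  subset_right : B ⊆ U
  preconnected_left : ((nodeGraph n).induce R).Preconnected
  preconnected_right : ((nodeGraph n).induce B).Preconnected
  far : (3 : ℕ) ≤ setDist (tree n) R B

namespace FarPair

theorem symm (h : FarPair U R B) : FarPair U B R :=
  ⟨h.subset_right, h.subset_left, h.preconnected_right, h.preconnected_left,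
    setDist_comm (G := tree n) R B ▸ h.far⟩

theorem disjoint (h : FarPair U R B) : Disjoint R B := disjoint_of_le_setDist (by norm_num) h.far

theorem two_lt_edist (h : FarPair U R B) (hu : u ∈ R) (hw : w ∈ B) : 2 < (tree n).edist u w :=
  lt_of_lt_of_le (by norm_num) (le_setDist_iff.1 h.far u hu w hw)

theorem not_adj (h : FarPair U R B) (hu : u ∈ R) (hw : w ∈ B) : ¬ (tree n).Adj u w := fun huw =>
  (h.two_lt_edist hu hw).not_ge
    ((edist_le_one_iff.2 (Or.inr huw)).trans one_le_two)

theorem not_adj_of_adj (h : FarPair U R B) (hu : u ∈ R) (hw : w ∈ B) (hut : (tree n).Adj u t) :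
    ¬ (tree n).Adj w t := fun hwt => by
  refine (h.two_lt_edist hu hw).not_ge ((SimpleGraph.edist_triangle (v := t)).trans ?_)
  exact (add_le_add (edist_le_one_iff.2 (Or.inr hut)) (edist_le_one_iff.2 (Or.inr hwt.symm))).trans
    one_add_one_eq_two.le

theorem restrict {R' B' : Set (Node n)} (h : FarPair V R B) (hR : R' ⊆ R ∩ U) (hB : B' ⊆ B ∩ U)
    (hRc : ((nodeGraph n).induce R').Preconnected) (hBc : ((nodeGraph n).induce B').Preconnected) :
    FarPair U R' B' where
  subset_left _ hu := (hR hu).2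
  subset_right _ hu := (hB hu).2
  preconnected_left := hRc
  preconnected_right := hBc
  far := le_setDist_iff.2 fun u hu w hw => le_setDist_iff.1 h.far u (hR hu).1 w (hB hw).1

end FarPair

theorem subsingleton_inter_column (hRB : Disjoint R B) (hB : (B ∩ column a).Nonempty) :
    (R ∩ column a).Subsingleton := by
  obtain ⟨z, hzB, hz⟩ := hB
  have : z ∉ R := hRB.notMem_of_mem_right hzB
  rintro u ⟨hu, hua⟩ w ⟨hw, hwa⟩
  simp only [column, Set.mem_insert_iff, Set.mem_singleton_iff] at hz hua hwa
  grind

theorem leaf_mem_or_leaf_mem (hRB : Disjoint R B) (hR : (R ∩ column a).Nonempty)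
    (hB : (B ∩ column a).Nonempty) : Node.leaf a ∈ R ∨ Node.leaf a ∈ B := by
  obtain ⟨u, hu, rfl | rfl⟩ := hR
  · exact Or.inl hu
  obtain ⟨w, hw, rfl | rfl⟩ := hB
  · exact Or.inr hw
  · exact absurd hw (hRB.notMem_of_mem_left hu)

/-- In the part `U` with top `t`, a red set crossing from column `a` to column `b` next to a blue
one that does the same has to use `t` and both outer leaves, or else the blue set does. The other
two conditions are for a red set that contains `t` but is only known to reach one of the columns. -/
structure RootControlled (U : Set (Node n)) (t : Node n) (a b : Fin (2 ^ n)) : Prop where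
  cross : ∀ {R B}, FarPair U R B → (R ∩ column a).Nonempty → (B ∩ column a).Nonempty →
    (R ∩ column b).Nonempty → (B ∩ column b).Nonempty →
      (t ∈ R ∧ .leaf a ∈ R ∧ .leaf b ∈ R) ∨ (t ∈ B ∧ .leaf a ∈ B ∧ .leaf b ∈ B)
  leaf_left : ∀ {R B}, FarPair U R B → t ∈ R → (R ∩ column a).Nonempty →
    (B ∩ column a).Nonempty → (B ∩ column b).Nonempty → .leaf a ∈ R
  leaf_right : ∀ {R B}, FarPair U R B → t ∈ R → (R ∩ column b).Nonempty →
    (B ∩ column a).Nonempty → (B ∩ column b).Nonempty → .leaf b ∈ R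

theorem RootControlled.symm (hU : RootControlled U t a b) : RootControlled U t b a where
  cross h hRb hBb hRa hBa :=
    (hU.cross h hRa hBa hRb hBb).imp (And.imp_right And.symm) (And.imp_right And.symm)
  leaf_left h ht hRb hBb hBa := hU.leaf_right h ht hRb hBa hBb
  leaf_right h ht hRa hBb hBa := hU.leaf_left h ht hRa hBa hBb

namespace IsJoin

theorem exit (J : IsJoin V U U' t t₁ t₂ a c d b) (hu : u ∈ U) (hw : w ∈ V) (hwU : w ∉ U)
    (huw : (nodeGraph n).Adj u w) : (u = t₁ ∧ w = t) ∨ (u ∈ column c ∧ w ∈ column d) := by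
  rcases J.subset hw with rfl | h | h
  · exact Or.inl ⟨J.eq_of_adj_left u hu huw, rfl⟩
  · exact absurd h hwU
  · exact Or.inr (J.mem_column_of_adj u hu w h huw)

theorem leaf_mem (J : IsJoin V U U' t t₁ t₂ a c d b) (hU : RootControlled U t₁ a c)
    (h : FarPair V R B) (ht : t ∈ R) (hRa : (R ∩ column a).Nonempty) (hBa : (B ∩ column a).Nonempty)
    (hBb : (B ∩ column b).Nonempty) : .leaf a ∈ R := by
  obtain ⟨x, hxR, hxa⟩ := hRa
  obtain ⟨y, hyB, hya⟩ := hBa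
  obtain ⟨z, hzB, hzb⟩ := hBb
  set C := componentIn (nodeGraph n) (R ∩ U) x
  set D := componentIn (nodeGraph n) (B ∩ U) y
  have hC : C ⊆ R ∩ U := componentIn_subset
  have hD : D ⊆ B ∩ U := componentIn_subset
  have hCD : FarPair U C D := h.restrict hC hD (preconnected_componentIn _ _)
    (preconnected_componentIn _ _)
  have hCa : (C ∩ column a).Nonempty := ⟨x, mem_componentIn_self ⟨hxR, J.outer_left hxa⟩, hxa⟩
  have hDa : (D ∩ column a).Nonempty := ⟨y, mem_componentIn_self ⟨hyB, J.outer_left hya⟩, hya⟩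
  have hDc : (D ∩ column c).Nonempty := by
    obtain ⟨u, hu, w, hw, huw⟩ := exists_adj_componentIn_inter h.preconnected_right
      ⟨hyB, J.outer_left hya⟩ ⟨z, hzB, J.disjoint.notMem_of_mem_right (J.outer_right hzb)⟩
    rcases J.exit (hD hu).2 (h.subset_right hw.1) hw.2 huw with ⟨-, rfl⟩ | ⟨huc, -⟩
    · exact absurd hw.1 (h.disjoint.notMem_of_mem_left ht)
    · exact ⟨u, hu, huc⟩
  obtain ⟨u, hu, w, hw, huw⟩ := exists_adj_componentIn_inter h.preconnected_left
    ⟨hxR, J.outer_left hxa⟩ ⟨t, ht, J.notMem_left⟩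
  rcases J.exit (hC hu).2 (h.subset_left hw.1) hw.2 huw with ⟨rfl, -⟩ | ⟨huc, -⟩
  · exact (hC (hU.leaf_left hCD hu hCa hDa hDc)).1
  · rcases hU.cross hCD hCa hDa ⟨u, hu, huc⟩ hDc with ⟨-, ha, -⟩ | ⟨ht₁, -⟩
    · exact (hC ha).1
    · exact absurd J.adj_left.symm (h.not_adj ht (hD ht₁).1)

theorem exists_crossing (J : IsJoin V U U' t t₁ t₂ a c d b) (hRV : R ⊆ V)
    (hR : ((nodeGraph n).induce R).Preconnected) (ht : t ∉ R) (hRa : (R ∩ column a).Nonempty)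
    (hRb : (R ∩ column b).Nonempty) :
    ∃ u ∈ R ∩ column c, ∃ w ∈ R ∩ column d, (nodeGraph n).Adj u w := by
  obtain ⟨x, hxR, hxa⟩ := hRa
  obtain ⟨y, hyR, hyb⟩ := hRb
  obtain ⟨u, hu, w, hw, huw⟩ := exists_adj_of_preconnected hR ⟨hxR, J.outer_left hxa⟩
    ⟨hyR, J.disjoint.notMem_of_mem_right (J.outer_right hyb)⟩
  rcases J.exit hu.2 (hRV hw.1) hw.2 huw with ⟨-, rfl⟩ | ⟨huc, hwd⟩
  · exact absurd hw.1 ht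
  · exact ⟨u, ⟨hu.1, huc⟩, w, ⟨hw.1, hwd⟩, huw⟩

theorem preconnected_inter (J : IsJoin V U U' t t₁ t₂ a c d b) {p : Node n} (hRV : R ⊆ V)
    (hR : ((nodeGraph n).induce R).Preconnected) (ht : t ∉ R) (hRc : (R ∩ column c).Subsingleton)
    (hp : p ∈ R ∩ column c) : ((nodeGraph n).induce (R ∩ U)).Preconnected := by
  refine preconnected_induce_inter_of_exits (p := p) hR fun u hu w hw huw => ?_
  rcases J.exit hu.2 (hRV hw.1) hw.2 huw with ⟨-, rfl⟩ | ⟨huc, -⟩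
  · exact absurd hw.1 ht
  · exact hRc ⟨hu.1, huc⟩ hp

/-- Both sets cross from column `c` to column `d` without using `t`, so each contains exactly one
node of either column. -/
theorem farPair_inter (J : IsJoin V U U' t t₁ t₂ a c d b) (h : FarPair V R B) (htR : t ∉ R)
    (htB : t ∉ B) (hRc : (R ∩ column c).Nonempty) (hBc : (B ∩ column c).Nonempty) :
    FarPair U (R ∩ U) (B ∩ U) :=
  h.restrict subset_rfl subset_rfl
    (J.preconnected_inter h.subset_left h.preconnected_left htR
      (subsingleton_inter_column h.disjoint hBc) hRc.some_mem)
    (J.preconnected_inter h.subset_right h.preconnected_right htB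
      (subsingleton_inter_column h.symm.disjoint hRc) hBc.some_mem)

theorem cross_inter (J : IsJoin V U U' t t₁ t₂ a c d b) (hU : RootControlled U t₁ a c)
    (h : FarPair V R B) (htR : t ∉ R) (htB : t ∉ B) (hRa : (R ∩ column a).Nonempty)
    (hBa : (B ∩ column a).Nonempty) (hRc : (R ∩ column c).Nonempty)
    (hBc : (B ∩ column c).Nonempty) : (t₁ ∈ R ∧ .leaf c ∈ R) ∨ (t₁ ∈ B ∧ .leaf c ∈ B) := by
  have inter : ∀ {X : Set (Node n)} {i}, column i ⊆ U → (X ∩ column i).Nonempty →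
      (X ∩ U ∩ column i).Nonempty := fun hi ⟨u, hu, hui⟩ => ⟨u, ⟨hu, hi hui⟩, hui⟩
  exact (hU.cross (J.farPair_inter h htR htB hRc hBc) (inter J.outer_left hRa)
    (inter J.outer_left hBa) (inter J.inner_left hRc) (inter J.inner_left hBc)).imp
    (fun hR => ⟨hR.1.1, hR.2.2.1⟩) (fun hB => ⟨hB.1.1, hB.2.2.1⟩)

theorem not_cross (J : IsJoin V U U' t t₁ t₂ a c d b) (hU : RootControlled U t₁ a c)
    (hU' : RootControlled U' t₂ d b) (h : FarPair V R B) (htR : t ∉ R) (htB : t ∉ B)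
    (hRa : (R ∩ column a).Nonempty) (hBa : (B ∩ column a).Nonempty)
    (hRb : (R ∩ column b).Nonempty) : ¬ (B ∩ column b).Nonempty := by
  intro hBb
  obtain ⟨u, hu, w, hw, huw⟩ := J.exists_crossing h.subset_left h.preconnected_left htR hRa hRb
  obtain ⟨u', hu', w', hw', huw'⟩ :=
    J.exists_crossing h.subset_right h.preconnected_right htB hBa hBb
  have left := J.cross_inter hU h htR htB hRa hBa ⟨u, hu⟩ ⟨u', hu'⟩
  have right := J.symm.cross_inter hU'.symm h htR htB hRb hBb ⟨w, hw⟩ ⟨w', hw'⟩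
  have eq_leaf : ∀ {X Y : Set (Node n)} {v : Node n} {i}, FarPair V X Y → (Y ∩ column i).Nonempty →
      v ∈ X ∩ column i → .leaf i ∈ X → v = .leaf i := fun hXY hY hv hi =>
    subsingleton_inter_column hXY.disjoint hY hv ⟨hi, leaf_mem_column _⟩
  rcases left with ⟨ht₁, hc⟩ | ⟨ht₁, hc⟩ <;> rcases right with ⟨ht₂, hd⟩ | ⟨ht₂, hd⟩
  · rw [eq_leaf h ⟨u', hu'⟩ hu hc, eq_leaf h ⟨w', hw'⟩ hw hd] at huw
    exact not_adj_leaf_leaf _ _ huw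
  · exact h.not_adj_of_adj ht₁ ht₂ J.adj_left J.adj_right
  · exact h.not_adj_of_adj ht₂ ht₁ J.adj_right J.adj_left
  · rw [eq_leaf h.symm ⟨u, hu⟩ hu' hc, eq_leaf h.symm ⟨w, hw⟩ hw' hd] at huw'
    exact not_adj_leaf_leaf _ _ huw'

theorem rootControlled (J : IsJoin V U U' t t₁ t₂ a c d b) (hU : RootControlled U t₁ a c)
    (hU' : RootControlled U' t₂ d b) : RootControlled V t a b where
  cross {R B} h hRa hBa hRb hBb := by
    by_cases htR : t ∈ R
    · exact Or.inl ⟨htR, J.leaf_mem hU h htR hRa hBa hBb,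
        J.symm.leaf_mem hU'.symm h htR hRb hBb hBa⟩
    by_cases htB : t ∈ B
    · exact Or.inr ⟨htB, J.leaf_mem hU h.symm htB hBa hRa hRb,
        J.symm.leaf_mem hU'.symm h.symm htB hBb hRb hRa⟩
    · exact absurd hBb (J.not_cross hU hU' h htR htB hRa hBa hRb)
  leaf_left h ht hRa hBa hBb := J.leaf_mem hU h ht hRa hBa hBb
  leaf_right h ht hRb hBa hBb := J.symm.leaf_mem hU'.symm h ht hRb hBb hBa

end IsJoin

theorem Spans.rootControlled {h k : ℕ} (S : Spans h k a b) :
    RootControlled (block n h k) S.top a b := by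
  induction h generalizing k a b with
  | zero =>
    have ha := S.first
    have hb := S.last
    simp only [pow_zero, mul_one] at ha hb
    obtain rfl : a = b := by omega
    have htop : S.top = .leaf a := congrArg Node.tree (Fin.ext ha)
    rw [htop]
    exact ⟨fun h hR hB _ _ => (leaf_mem_or_leaf_mem h.disjoint hR hB).imp
      (fun h => ⟨h, h, h⟩) (fun h => ⟨h, h, h⟩), fun _ h _ _ _ => h, fun _ h _ _ _ => h⟩
  | succ h ih =>
    obtain ⟨c, d, hcd, S₁, S₂⟩ := S.exists_halves
    exact (S.isJoin S₁ S₂ hcd).rootControlled (ih S₁) (ih S₂)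

end Coloring

section CliqueLocation

variable {n h k : ℕ} {a b c d : Fin (2 ^ n)} {u w : Node n}
  {B : Fin 15 → Set (Node n)} {P : Sym2 (Fin 15) → Set (Node n)}

namespace Spans

/-- The nodes of the block through which it can be left. -/
def boundary (S : Spans h k a b) : Finset (Node n) := {S.top, .leaf a, .row a, .leaf b, .row b}

/-- The nodes of the block whose neighbours all belong to the block. -/
def interior (S : Spans h k a b) : Set (Node n) := block n h k \ S.boundary

theorem mem_boundary (S : Spans h k a b) :
    u ∈ S.boundary ↔ u = S.top ∨ u ∈ column a ∨ u ∈ column b := by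
  simp only [boundary, column, Finset.mem_insert, Finset.mem_singleton, Set.mem_insert_iff,
    Set.mem_singleton_iff, or_assoc]

theorem mem_block_of_adj (S : Spans h k a b) (hu : u ∈ S.interior) (huw : (nodeGraph n).Adj u w) :
    w ∈ block n h k := by
  by_contra hw
  exact hu.2 (S.mem_boundary.2 (S.eq_top_or_mem_column_of_adj hu.1 hw huw))

theorem interior_eq_empty (S : Spans 0 k a b) : S.interior = ∅ := by
  refine Set.eq_empty_of_forall_notMem fun u hu => hu.2 (S.mem_boundary.2 ?_)
  have ha := S.first
  rcases u with j | i | _ | _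
  · obtain ⟨m, hm, hj⟩ := hu.1
    obtain rfl : m = 0 := by omega
    exact Or.inl (congrArg Node.tree (Fin.ext (by simpa using hj)))
  · have hi : (2 ^ n + (i : ℕ)) / 2 ^ 0 = k := hu.1
    obtain rfl : i = a := by
      simp only [pow_zero, Nat.div_one, mul_one] at hi ha
      omega
    exact Or.inr (Or.inl (row_mem_column i))
  · exact hu.1.elim
  · exact hu.1.elim

theorem small_interior {P : Sym2 (Fin 15) → Set (Node n)} (M : IsCliqueModel (nodeGraph n) B P)
    (S : Spans h k a b) : Small B S.interior := by
  induction h generalizing k a b with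
  | zero => exact S.interior_eq_empty ▸ M.small_empty
  | succ h ih =>
    obtain ⟨c, d, hcd, S₁, S₂⟩ := S.exists_halves
    have J := S.isJoin S₁ S₂ hcd
    refine M.small_of_cut (Z₀ := S.boundary)
      (Z := S.boundary ∪ {S₁.top, S₂.top, .leaf c, .row c, .leaf d, .row d})
      Finset.subset_union_left ?_ ?_ (fun u hu w huw => ?_) (fun u hu => ?_)
      (fun u hu w hw huw => ?_) (ih S₁) (ih S₂)
    · exact (Nat.add_le_add_right Finset.card_le_five 2).trans_lt (by norm_num)
    · exact ((Finset.card_union_le _ _).trans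
        (Nat.add_le_add Finset.card_le_five Finset.card_le_six)).trans_lt (by norm_num)
    · have hw := S.mem_block_of_adj hu huw
      by_cases hwS : w ∈ S.boundary
      · exact Or.inr hwS
      · exact Or.inl ⟨hw, hwS⟩
    · have hS := fun h => hu.2 (S.mem_boundary.2 h)
      by_cases hZ : u ∈ ({S₁.top, S₂.top, .leaf c, .row c, .leaf d, .row d} : Finset (Node n))
      · exact Or.inl (Finset.mem_union_right _ hZ)
      simp only [Finset.mem_insert, Finset.mem_singleton, not_or] at hZ
      have hc : u ∉ column c := fun h => h.elim hZ.2.2.1 hZ.2.2.2.1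
      have hd : u ∉ column d := fun h => h.elim hZ.2.2.2.2.1 hZ.2.2.2.2.2
      rcases J.subset hu.1 with h | h | h
      · exact absurd (Or.inl h) hS
      · refine Or.inr (Or.inl ⟨h, fun h' => ?_⟩)
        rcases S₁.mem_boundary.1 h' with h' | h' | h'
        exacts [hZ.1 h', hS (Or.inr (Or.inl h')), hc h']
      · refine Or.inr (Or.inr ⟨h, fun h' => ?_⟩)
        rcases S₂.mem_boundary.1 h' with h' | h' | h'
        exacts [hZ.2.1 h', hd h', hS (Or.inr (Or.inr h'))]
    · exact hu.2 (S₁.mem_boundary.2 (Or.inr (Or.inr (J.mem_column_of_adj u hu.1 w hw.1 huw).1)))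

end Spans

/-- The nodes outside the two cliques. -/
def middle : Set (Node n) := {u | (∃ j, u = .tree j) ∨ ∃ i, u = .row i}

/-- The vertices of clique `s` and the nodes on its connections. -/
def clique (s : Bool) : Set (Node n) := {u | (∃ i, u = .hub s i) ∨ ∃ i j, u = .port s i j}

/-- The vertices of clique `s` that are attached to the rest of the graph. -/
def attached (s : Bool) : Finset (Node n) := {.hub s 0, .hub s 1, .hub s 2}

/-- The nodes of clique `s` whose neighbours all belong to the clique. -/
def cliqueInterior (s : Bool) : Set (Node n) := clique s \ (attached s : Finset (Node n))

theorem hub_mem_attached {s : Bool} {i : Fin 15} (hi : (i : ℕ) < 3) :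
    Node.hub s i ∈ (attached s : Finset (Node n)) := by
  have : i = 0 ∨ i = 1 ∨ i = 2 := by omega
  rcases this with rfl | rfl | rfl <;> simp [attached]

theorem mem_middle_or_exists_mem_clique (u : Node n) : u ∈ middle ∨ ∃ s, u ∈ clique s := by
  rcases u with j | i | ⟨s, i⟩ | ⟨s, i, j⟩
  · exact Or.inl (Or.inl ⟨j, rfl⟩)
  · exact Or.inl (Or.inr ⟨i, rfl⟩)
  · exact Or.inr ⟨s, Or.inl ⟨i, rfl⟩⟩
  · exact Or.inr ⟨s, Or.inr ⟨i, j, rfl⟩⟩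

theorem notMem_clique_of_mem_middle {s : Bool} (hu : u ∈ middle) : u ∉ clique s := by
  rcases hu with ⟨j, rfl⟩ | ⟨i, rfl⟩ <;> rintro (⟨i, h⟩ | ⟨i, j, h⟩) <;> cases h

theorem column_subset_middle : column a ⊆ middle := by
  rintro _ (rfl | rfl)
  exacts [Or.inl ⟨_, rfl⟩, Or.inr ⟨_, rfl⟩]

theorem mem_attached_of_adj {s : Bool} (hu : u ∈ clique s) (hw : w ∉ clique s)
    (huw : (nodeGraph n).Adj u w) : u ∈ attached s ∧ (w = .apex ∨ w ∈ column (endCol s)) := by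
  have not_column : ∀ {i}, u ∉ column i := fun hui =>
    notMem_clique_of_mem_middle (column_subset_middle hui) hu
  rcases hu with ⟨i, rfl⟩ | ⟨i, j, rfl⟩ <;> rcases nodeLink_of_adj huw with huw | huw
  · cases huw with
    | column _ hui _ => exact absurd hui not_column
    | hubApex s => exact ⟨hub_mem_attached (by norm_num), Or.inl rfl⟩
    | hubColumn s hi hws => exact ⟨hub_mem_attached hi, Or.inr hws⟩
    | hubPort s i j => exact absurd (Or.inr ⟨i, j, rfl⟩) hw
  · cases huw with
    | column _ _ hui => exact absurd hui not_column
    | hubColumn _ _ hui => exact absurd hui not_column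
  · cases huw with
    | column _ hui _ => exact absurd hui not_column
    | portPort s i j => exact absurd (Or.inr ⟨j, i, rfl⟩) hw
  · cases huw with
    | column _ _ hui => exact absurd hui not_column
    | hubColumn _ _ hui => exact absurd hui not_column
    | hubPort s i j => exact absurd (Or.inl ⟨i, rfl⟩) hw
    | portPort s i j => exact absurd (Or.inr ⟨_, _, rfl⟩) hw

theorem mem_middle_or_mem_attached_of_adj (hu : u ∈ middle) (huw : (nodeGraph n).Adj u w) :
    w ∈ middle ∨ w ∈ (attached false ∪ attached true : Finset (Node n)) := by
  refine (mem_middle_or_exists_mem_clique w).imp_right ?_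
  rintro ⟨s, hw⟩
  have hws := (mem_attached_of_adj hw (notMem_clique_of_mem_middle hu) huw.symm).1
  cases s
  exacts [Finset.mem_union_left _ hws, Finset.mem_union_right _ hws]

theorem mem_cliqueInterior_or_mem_attached_of_adj {s : Bool} (hu : u ∈ cliqueInterior s)
    (huw : (nodeGraph n).Adj u w) : w ∈ cliqueInterior s ∨ w ∈ (attached s : Finset (Node n)) := by
  by_cases hw : w ∈ (attached s : Finset (Node n))
  · exact Or.inr hw
  · exact Or.inl ⟨by_contra fun h => hu.2 (mem_attached_of_adj hu.1 h huw).1, hw⟩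

theorem eq_of_adj_port {s : Bool} {i j : Fin 15} (huw : (nodeGraph n).Adj (.port s i j) w) :
    w = .hub s i ∨ w = .port s j i := by
  have port_notMem_column : ∀ {i' : Fin (2 ^ n)}, Node.port s i j ∉ column i' := fun h =>
    notMem_clique_of_mem_middle (column_subset_middle h) (Or.inr ⟨i, j, rfl⟩)
  rcases nodeLink_of_adj huw with huw | huw
  · cases huw with
    | column _ h _ => exact absurd h port_notMem_column
    | portPort => exact Or.inr rfl
  · cases huw with
    | column _ _ h => exact absurd h port_notMem_column
    | hubColumn _ _ h => exact absurd h port_notMem_column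
    | hubPort => exact Or.inl rfl
    | portPort => exact Or.inr rfl

theorem middle_subset : middle ⊆ insert .apex (block n n 1) := by
  rintro _ (⟨j, rfl⟩ | ⟨i, rfl⟩)
  · by_cases hj : (j : ℕ) = 0
    · exact Or.inl (congrArg Node.tree (Fin.ext hj))
    · refine Or.inr ⟨Nat.log 2 j, Nat.lt_succ_iff.1 (Nat.log_lt_of_lt_pow hj j.2), ?_⟩
      rw [div_pow_eq_iff, one_mul, ← pow_succ']
      exact ⟨Nat.pow_log_le_self 2 hj, Nat.lt_pow_succ_log_self one_lt_two j⟩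
  · exact Or.inr ((spans_root.mem_block_iff (row_mem_column i)).2
      ⟨Nat.zero_le _, Nat.le_sub_one_of_lt i.2⟩)

theorem card_attached_union_le :
    (attached false ∪ attached true : Finset (Node n)).card ≤ 6 :=
  (Finset.card_union_le _ _).trans (Nat.add_le_add Finset.card_le_three Finset.card_le_three)

section Model

variable (M : IsCliqueModel (nodeGraph n) B P)
include M

theorem small_middle : Small B middle := by
  refine M.small_of_cut (Z₀ := attached false ∪ attached true)
    (Z := attached false ∪ attached true ∪ insert .apex spans_root.boundary)
    (X₁ := spans_root.interior) (X₂ := ∅) Finset.subset_union_left ?_ ?_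
    (fun u hu w => mem_middle_or_mem_attached_of_adj hu) (fun u hu => ?_)
    (fun _ _ _ => False.elim) (spans_root.small_interior M) M.small_empty
  · exact (Nat.add_le_add_right card_attached_union_le 2).trans_lt (by norm_num)
  · exact ((Finset.card_union_le _ _).trans (Nat.add_le_add card_attached_union_le
      ((Finset.card_insert_le _ _).trans (Nat.succ_le_succ Finset.card_le_five)))).trans_lt
      (by norm_num)
  · rw [Finset.coe_union, Finset.coe_insert]
    rcases middle_subset hu with rfl | hu
    · exact Or.inl (Or.inr (Or.inl rfl))
    · by_cases h : u ∈ spans_root.boundary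
      exacts [Or.inl (Or.inr (Or.inr h)), Or.inr (Or.inl ⟨hu, h⟩)]

theorem small_ports (s : Bool) (i j : Fin 15) : Small B {.port s i j, .port s j i} := by
  refine M.small_of_cut (Z₀ := {.hub s i, .hub s j})
    (Z := {.hub s i, .hub s j, .port s i j, .port s j i}) (X₁ := ∅) (X₂ := ∅) (by grind)
    ((Nat.add_le_add_right Finset.card_le_two 2).trans_lt (by norm_num))
    (Finset.card_le_four.trans_lt (by norm_num)) ?_ ?_ (fun _ h => h.elim) M.small_empty
    M.small_empty
  · rintro u (rfl | rfl) w huw <;> rcases eq_of_adj_port huw with rfl | rfl <;> simp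
  · rintro u (rfl | rfl) <;> simp

theorem exists_subset_cliqueInterior : ∃ s i, B i ⊆ cliqueInterior s := by
  obtain ⟨i, hi⟩ := M.exists_disjoint (Z := attached false ∪ attached true)
    (card_attached_union_le.trans_lt (by norm_num))
  have hi_attached : ∀ {u s}, u ∈ B i → u ∉ (attached s : Finset (Node n)) := fun {u s} hu hus =>
    hi.notMem_of_mem_left hu (by cases s <;> simp [hus])
  by_contra! hn
  have hdisj : ∀ s, Disjoint (B i) (cliqueInterior s) := fun s =>
    (subset_or_disjoint_of_preconnected (M.preconnected_branch i) fun u hu w hw huw =>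
      (mem_cliqueInterior_or_mem_attached_of_adj hu.2 huw).resolve_right
        (hi_attached hw)).resolve_left (hn s i)
  refine small_middle M i fun u hu => (mem_middle_or_exists_mem_clique u).resolve_right ?_
  rintro ⟨s, hus⟩
  exact (hdisj s).notMem_of_mem_left hu ⟨hus, hi_attached hu⟩

theorem exists_clique_forall_hub_mem : ∃ s, ∀ j, ∃ i, Node.hub s i ∈ B j := by
  obtain ⟨s, i, hi⟩ := exists_subset_cliqueInterior M
  refine ⟨s, fun j => ?_⟩
  by_contra! hn
  have hj_attached : Disjoint (B j) (attached s : Finset (Node n)) := by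
    rw [Set.disjoint_left]
    intro u hu hus
    simp only [attached, Finset.coe_insert, Finset.coe_singleton, Set.mem_insert_iff,
      Set.mem_singleton_iff] at hus
    rcases hus with rfl | rfl | rfl <;> exact hn _ hu
  rcases subset_or_disjoint_of_preconnected (M.preconnected_branch j) fun u hu w hw huw =>
    (mem_cliqueInterior_or_mem_attached_of_adj hu.2 huw).resolve_right
      (hj_attached.notMem_of_mem_left hw) with hj | hj
  · have eq_port : ∀ u ∈ B j, ∃ i k, u = .port s i k := fun u hu =>
      (hj hu).1.resolve_left fun ⟨k, hk⟩ => hn k (hk ▸ hu)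
    obtain ⟨u, hu⟩ := M.nonempty j
    obtain ⟨i, k, rfl⟩ := eq_port u hu
    refine small_ports M s i k j (preconnected_induce_iff_forall_subset.1
      (M.preconnected_branch j) _ (fun v hv w hw hvw => ?_) ⟨_, hu, Or.inl rfl⟩)
    obtain ⟨i', k', rfl⟩ := eq_port w hw
    rcases hv.2 with rfl | rfl <;> rcases eq_of_adj_port hvw with h | h <;> simp_all
  · exact M.not_separated (Z := attached s)
      ((Nat.add_le_add_right Finset.card_le_three 2).trans_lt (by norm_num))
      (fun u hu w => mem_cliqueInterior_or_mem_attached_of_adj hu) hi hj hj_attached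

end Model

end CliqueLocation

section Connections

variable {n : ℕ} {Q R B : Set (Node n)}

theorem apex_mem_or_inter_column_nonempty (hQ : ((nodeGraph n).induce Q).Preconnected)
    (hub_mem : ∀ s, ∃ i, Node.hub s i ∈ Q) (s : Bool) :
    .apex ∈ Q ∨ (Q ∩ column (endCol s)).Nonempty := by
  obtain ⟨i, hi⟩ := hub_mem s
  obtain ⟨j, hj⟩ := hub_mem !s
  have hjs : Node.hub (!s) j ∉ clique (n := n) s := by
    rintro (⟨_, h⟩ | ⟨_, _, h⟩) <;> simp at h
  obtain ⟨u, hu, w, hw, huw⟩ := exists_adj_of_preconnected hQ ⟨hi, Or.inl ⟨i, rfl⟩⟩ ⟨hj, hjs⟩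
  rcases (mem_attached_of_adj hu.2 hw.2 huw).2 with rfl | hws
  exacts [Or.inl hw.1, Or.inr ⟨w, hw.1, hws⟩]

theorem preconnected_inter_middle (hQ : ((nodeGraph n).induce Q).Preconnected)
    (h_apex : .apex ∉ Q) (hne : ∀ s, (Q ∩ column (endCol s)).Nonempty)
    (hsub : ∀ s, (Q ∩ column (endCol s)).Subsingleton) :
    ((nodeGraph n).induce (Q ∩ middle)).Preconnected := by
  have diff_clique : ∀ s {Q'}, Q' ⊆ Q → ((nodeGraph n).induce Q').Preconnected →
      ((nodeGraph n).induce (Q' ∩ (clique s)ᶜ)).Preconnected := by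
    intro s Q' hQ'Q hQ'
    obtain ⟨p, hp⟩ := hne s
    refine preconnected_induce_inter_of_exits (p := p) hQ' fun u hu w hw huw => ?_
    have hus := (mem_attached_of_adj (not_not.1 hw.2) hu.2 huw.symm).2
    exact hsub s ⟨hQ'Q hu.1, hus.resolve_left fun h => h_apex (h ▸ hQ'Q hu.1)⟩ hp
  have hQ_middle : Q ∩ middle = Q ∩ (clique false)ᶜ ∩ (clique true)ᶜ := by
    ext u
    constructor
    · exact fun ⟨hu, hum⟩ =>
        ⟨⟨hu, notMem_clique_of_mem_middle hum⟩, notMem_clique_of_mem_middle hum⟩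
    · rintro ⟨⟨hu, hf⟩, ht⟩
      refine ⟨hu, (mem_middle_or_exists_mem_clique u).resolve_right ?_⟩
      rintro ⟨_ | _, hus⟩
      exacts [hf hus, ht hus]
  exact hQ_middle ▸ diff_clique true Set.inter_subset_left (diff_clique false subset_rfl hQ)

theorem FarPair.top_mem_or_top_mem (h : FarPair Set.univ R B) (hR : .apex ∉ R) (hB : .apex ∉ B)
    (hR_col : ∀ s, (R ∩ column (endCol s)).Nonempty)
    (hB_col : ∀ s, (B ∩ column (endCol s)).Nonempty) :
    spans_root.top ∈ R ∨ spans_root.top ∈ B := by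
  have subset_block : ∀ {Q : Set (Node n)}, .apex ∉ Q → Q ∩ middle ⊆ Q ∩ block n n 1 :=
    fun hQ u hu => ⟨hu.1, (middle_subset hu.2).resolve_left fun h => hQ (h ▸ hu.1)⟩
  have inter_column : ∀ {Q : Set (Node n)} {i}, (Q ∩ column i).Nonempty →
      (Q ∩ middle ∩ column i).Nonempty := fun ⟨u, hu, hui⟩ =>
    ⟨u, ⟨hu, column_subset_middle hui⟩, hui⟩
  have h_block : FarPair (block n n 1) (R ∩ middle) (B ∩ middle) :=
    h.restrict (subset_block hR) (subset_block hB)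
      (preconnected_inter_middle h.preconnected_left hR hR_col fun s =>
        subsingleton_inter_column h.disjoint (hB_col s))
      (preconnected_inter_middle h.preconnected_right hB hB_col fun s =>
        subsingleton_inter_column h.symm.disjoint (hR_col s))
  exact (spans_root.rootControlled.cross h_block (inter_column (hR_col _))
    (inter_column (hB_col _)) (inter_column (hR_col _)) (inter_column (hB_col _))).imp
    (fun h => h.1.1) (fun h => h.1.1)

theorem adj_top_apex : (tree n).Adj spans_root.top .apex :=
  show _ ≠ _ ∧ _ from ⟨by simp [Fin.ext_iff], Or.inr (by norm_num)⟩

/-- One of three connections uses the apex, since a column has only two nodes; one of the other two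
then uses the root, which is adjacent to the apex. -/
theorem no_three_connections {Q : Fin 3 → Set (Node n)}
    (hQ : ∀ c, ((nodeGraph n).induce (Q c)).Preconnected)
    (far : Pairwise fun c d => ((3 : ℕ) : ℕ∞) ≤ setDist (tree n) (Q c) (Q d))
    (hub_mem : ∀ c s, ∃ i, Node.hub s i ∈ Q c) : False := by
  have farPair : ∀ {c d}, c ≠ d → FarPair Set.univ (Q c) (Q d) := fun hcd =>
    ⟨Set.subset_univ _, Set.subset_univ _, hQ _, hQ _, far hcd⟩
  obtain ⟨c₀, hc₀⟩ : ∃ c, .apex ∈ Q c := by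
    by_contra! hn
    have hle := card_le_card_of_forall_inter_nonempty (I := Finset.univ)
      (Z := {.leaf (endCol false), .row (endCol false)}) (F := Q)
      (fun c _ d _ hcd => (farPair hcd).disjoint) fun c _ => by
        simpa [column] using (apex_mem_or_inter_column_nonempty (hQ c) (hub_mem c)
          false).resolve_left (hn c)
    exact absurd (hle.trans Finset.card_le_two) (by simp)
  have apex_notMem : ∀ {c}, c₀ ≠ c → Node.apex ∉ Q c := fun hc =>
    (farPair hc).disjoint.notMem_of_mem_left hc₀
  have inter_column : ∀ {c}, c₀ ≠ c → ∀ s, (Q c ∩ column (endCol s)).Nonempty := fun hc s =>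
    (apex_mem_or_inter_column_nonempty (hQ _) (hub_mem _) s).resolve_left (apex_notMem hc)
  have top_notMem : ∀ {c}, c₀ ≠ c → spans_root.top ∉ Q c := fun hc h =>
    (farPair hc).not_adj hc₀ h adj_top_apex.symm
  obtain ⟨c, d, hc, hd, hcd⟩ : ∃ c d, c₀ ≠ c ∧ c₀ ≠ d ∧ c ≠ d := by
    clear * -
    revert c₀
    decide
  rcases (farPair hcd).top_mem_or_top_mem (apex_notMem hc) (apex_notMem hd) (inter_column hc)
    (inter_column hd) with h | h
  exacts [top_notMem hc h, top_notMem hd h]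

end Connections

section FatMinorModel

variable {α ι V : Type*} {H : SimpleGraph α} {G : SimpleGraph V} {K : ℕ} {B : α → Set V}
  {P : H.edgeSet → Set V} {u v x y : α} {e f : H.edgeSet}

theorem setDist_union_left (X Y Z : Set V) :
    setDist G (X ∪ Y) Z = setDist G X Z ⊓ setDist G Y Z := iInf_union

theorem setDist_union_right (X Y Z : Set V) :
    setDist G X (Y ∪ Z) = setDist G X Y ⊓ setDist G X Z := by
  rw [setDist_comm, setDist_union_left, setDist_comm Y, setDist_comm Z]

namespace IsFatMinorModel

theorem preconnected_join (M : IsFatMinorModel K H G B P) (he : (e : Sym2 α) = s(u, v)) :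
    (G.induce (B u ∪ P e ∪ B v)).Preconnected :=
  (SimpleGraph.induce_union_connected (SimpleGraph.induce_union_connected
    (M.connected_branch u).preconnected (M.connected_edge e).preconnected
    (M.meet u e (he ▸ Sym2.mem_mk_left u v))).preconnected (M.connected_branch v).preconnected
    ((M.meet v e (he ▸ Sym2.mem_mk_right u v)).mono fun _ hx => ⟨Or.inr hx.2, hx.1⟩)).preconnected

theorem le_setDist_join (M : IsFatMinorModel K H G B P) (he : (e : Sym2 α) = s(u, v))
    (hf : (f : Sym2 α) = s(x, y)) (hux : u ≠ x) (huy : u ≠ y) (hvx : v ≠ x) (hvy : v ≠ y) :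
    K ≤ setDist G (B u ∪ P e ∪ B v) (B x ∪ P f ∪ B y) := by
  have hef : e ≠ f := by
    rintro rfl
    have hu : u ∈ s(x, y) := hf ▸ he ▸ Sym2.mem_mk_left u v
    exact (Sym2.mem_iff.1 hu).elim hux huy
  have branch_f : ∀ {w}, w ≠ x → w ≠ y → K ≤ setDist G (B w) (P f) := fun hx hy =>
    M.branch_edge _ _ (by simp [hf, hx, hy])
  have edge_branch : ∀ {w}, u ≠ w → v ≠ w → K ≤ setDist G (P e) (B w) := fun hu hv =>
    setDist_comm (G := G) _ _ ▸ M.branch_edge _ _ (by simp [he, hu.symm, hv.symm])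
  simp only [setDist_union_left, setDist_union_right, le_inf_iff]
  exact ⟨⟨⟨⟨M.branch_branch _ _ hux, edge_branch hux hvx⟩, M.branch_branch _ _ hvx⟩,
    ⟨branch_f hux huy, M.edge_edge _ _ hef⟩, branch_f hvx hvy⟩,
    ⟨M.branch_branch _ _ huy, edge_branch huy hvy⟩, M.branch_branch _ _ hvy⟩

theorem isCliqueModel (M : IsFatMinorModel K H G B P) (hK : 1 ≤ K) (φ : (⊤ : SimpleGraph ι) →g H) :
    IsCliqueModel G (fun i => B (φ i))
      (fun e => (⋃ e' ∈ {e' : H.edgeSet | (e' : Sym2 α) = e.map φ}, P e') \ ⋃ v, B v) where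
  nonempty i := Set.nonempty_coe_sort.1 (M.connected_branch (φ i)).nonempty
  preconnected_branch i := (M.connected_branch (φ i)).preconnected
  preconnected_join i j hij := by
    let e : H.edgeSet := ⟨s(φ i, φ j), φ.map_adj hij⟩
    have edge_eq : (⋃ e' ∈ {e' : H.edgeSet | (e' : Sym2 α) = s(i, j).map φ}, P e') = P e := by
      have : {e' : H.edgeSet | (e' : Sym2 α) = s(i, j).map φ} = {e} :=
        Set.ext fun e' => (Subtype.ext_iff (a2 := e)).symm
      rw [this, Set.biUnion_singleton]
    have join_eq : B (φ i) ∪ P e \ (⋃ v, B v) ∪ B (φ j) = B (φ i) ∪ P e ∪ B (φ j) := by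
      refine (Set.union_subset_union_left _ (Set.union_subset_union_right _
        Set.sdiff_subset)).antisymm (Set.union_subset (Set.union_subset (fun x hx => ?_)
          fun x hx => ?_) Set.subset_union_right)
      · exact Or.inl (Or.inl hx)
      by_cases hxB : x ∈ ⋃ v, B v
      · obtain ⟨v, hxv⟩ := Set.mem_iUnion.1 hxB
        have hv : v ∈ (e : Sym2 α) :=
          not_not.1 fun hv => (M.disjoint_branch_edge hK hv).notMem_of_mem_left hxv hx
        rcases Sym2.mem_iff.1 hv with rfl | rfl
        exacts [Or.inl (Or.inl hxv), Or.inr hxv]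
      · exact Or.inl (Or.inr ⟨hx, hxB⟩)
    rw [edge_eq, join_eq]
    exact M.preconnected_join rfl
  disjoint_branch i j hij := M.disjoint_branch hK (φ.injective_of_top_hom.ne hij)
  disjoint_edge e f hef := by
    have : Disjoint (⋃ e' ∈ {e' : H.edgeSet | (e' : Sym2 α) = e.map φ}, P e')
        (⋃ f' ∈ {f' : H.edgeSet | (f' : Sym2 α) = f.map φ}, P f') := by
      simp only [Set.disjoint_iUnion_left, Set.disjoint_iUnion_right]
      rintro f' hf' e' he'
      refine M.disjoint_edge hK fun h => hef ?_
      exact Sym2.map.injective φ.injective_of_top_hom (he'.symm.trans (h ▸ hf'))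
    exact this.mono Set.sdiff_subset Set.sdiff_subset
  disjoint_branch_edge i e :=
    Set.disjoint_sdiff_right.mono_left (Set.subset_iUnion B (φ i))

end IsFatMinorModel

end FatMinorModel

section NotFatMinor

/-- The edge `x_c y_c` of `linkedK15`. -/
def crossEdge (c : Fin 3) : linkedK15.edgeSet :=
  ⟨s(.inl (Fin.castLE (by norm_num) c), .inr (Fin.castLE (by norm_num) c)), rfl, c.2⟩

/-- The two complete graphs in `linkedK15`. -/
def cliqueHom : Bool → (⊤ : SimpleGraph (Fin 15)) →g linkedK15
  | false => ⟨Sum.inl, id⟩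
  | true => ⟨Sum.inr, id⟩

variable {n L K : ℕ} {B : Fin 15 ⊕ Fin 15 → Set (Node n ⊕ LongEdge n × Fin L)}
  {P : linkedK15.edgeSet → Set (Node n ⊕ LongEdge n × Fin L)}

theorem exists_clique_forall_inl_hub_mem (M : IsFatMinorModel K linkedK15 (fatGraph n L) B P)
    (hK : 1 ≤ K) (s : Bool) : ∃ t, ∀ j, ∃ i, Sum.inl (Node.hub t i) ∈ B (cliqueHom s j) :=
  exists_clique_forall_hub_mem ((M.isCliqueModel hK (cliqueHom s)).preimage_inl (by simp))

theorem exists_inl_hub_mem (M : IsFatMinorModel K linkedK15 (fatGraph n L) B P) (hK : 1 ≤ K)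
    (t : Bool) : ∃ s, ∀ j, ∃ i, Sum.inl (Node.hub t i) ∈ B (cliqueHom s j) := by
  choose σ hσ using exists_clique_forall_inl_hub_mem M hK
  have σ_ne : σ false ≠ σ true := by
    intro heq
    have hub_mem : ∀ v, ∃ i, Sum.inl (Node.hub (σ false) i) ∈ B v := by
      rintro (j | j)
      exacts [hσ false j, heq ▸ hσ true j]
    choose f hf using hub_mem
    have f_injective : Function.Injective f := fun u v huv => not_not.1 fun hne =>
      (M.disjoint_branch hK hne).notMem_of_mem_left (hf u) (huv ▸ hf v)
    exact absurd (Fintype.card_le_of_injective f f_injective) (by simp)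
  obtain ⟨s, rfl⟩ : ∃ s, σ s = t := by
    by_contra! hn
    exact σ_ne ((Bool.eq_not_of_ne (hn false)).trans (Bool.eq_not_of_ne (hn true)).symm)
  exact ⟨s, hσ s⟩

theorem not_isFatMinor (n L : ℕ) : ¬ IsFatMinor 3 linkedK15 (fatGraph n L) := by
  rintro ⟨B, P, M⟩
  refine no_three_connections (Q := fun c => Sum.inl ⁻¹' (B (.inl (Fin.castLE (by norm_num) c)) ∪
    P (crossEdge c) ∪ B (.inr (Fin.castLE (by norm_num) c)))) (fun c => ?_)
    (fun c d hcd => ?_) (fun c t => ?_)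
  · exact preconnected_preimage_inl (M.preconnected_join rfl)
  · have hcd' := (Fin.castLE_injective (by norm_num : 3 ≤ 15)).ne hcd
    exact le_setDist_preimage_inl (M.le_setDist_join rfl rfl (Sum.inl_injective.ne hcd')
      Sum.inl_ne_inr Sum.inr_ne_inl (Sum.inr_injective.ne hcd'))
  · obtain ⟨s, hs⟩ := exists_inl_hub_mem M (by norm_num) t
    obtain ⟨i, hi⟩ := hs (Fin.castLE (by norm_num) c)
    cases s
    exacts [⟨i, Or.inl (Or.inl hi)⟩, ⟨i, Or.inr hi⟩]

end NotFatMinor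

section Labels

variable {E Λ : Type*} {ends : E → Sym2 Λ} {A : Set E} {e : E} {x y ℓ : Λ}

/-- The labels of the ends of the edges in `A`, where `ends e` consists of the labels of the two
ends of `e`. -/
def labels (ends : E → Sym2 Λ) (A : Set E) : Set Λ := {ℓ | ∃ e ∈ A, ℓ ∈ ends e}

/-- The line graph: two edges are adjacent if they share the label of an end. -/
def shareGraph (ends : E → Sym2 Λ) : SimpleGraph E :=
  .fromRel fun e f => ∃ ℓ, ℓ ∈ ends e ∧ ℓ ∈ ends f

theorem labels_insert (he : ends e = s(x, y)) :
    labels ends (insert e A) = insert x (insert y (labels ends A)) := by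
  ext ℓ
  simp [labels, he, or_assoc]

theorem labels_singleton (he : ends e = s(x, y)) : labels ends {e} = {x, y} := by
  ext ℓ
  simp [labels, he]

theorem labels_insert_of_mem (he : ends e = s(x, y)) (hy : y ∈ labels ends A) :
    labels ends (insert e A) = insert x (labels ends A) := by
  rw [labels_insert he, Set.insert_eq_of_mem hy]

theorem preconnected_shareGraph_insert (hA : ((shareGraph ends).induce A).Preconnected)
    (hℓ : ℓ ∈ labels ends A) (he : ℓ ∈ ends e) :
    ((shareGraph ends).induce (insert e A)).Preconnected := by
  obtain ⟨f, hf, hfℓ⟩ := hℓ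
  by_cases hef : f = e
  · rwa [Set.insert_eq_of_mem (hef ▸ hf)]
  · exact preconnected_induce_insert hA hf ⟨hef, Or.inl ⟨ℓ, hfℓ, he⟩⟩

theorem preconnected_shareGraph_of_forall_mem (hA : ∀ e ∈ A, ℓ ∈ ends e) :
    ((shareGraph ends).induce A).Preconnected := by
  rintro ⟨e, he⟩ ⟨f, hf⟩
  by_cases hef : e = f
  · exact hef ▸ .rfl
  · exact SimpleGraph.Adj.reachable
      (show (shareGraph ends).Adj e f from ⟨hef, Or.inl ⟨ℓ, hA e he, hA f hf⟩⟩)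

end Labels

section RightPaths

variable {n : ℕ} {K : Type*} {κ : Fin (2 ^ n) → K} {i j : Fin (2 ^ n)} {k : K} {u : Node n}
  {ℓ ℓ' : Node n ⊕ K} {S S' : Set (Node n ⊕ K)} {c d : Fin 3} {A B : Set (LongEdge n)}

/-- The label of a node: the label `κ i` for the leaf in column `i`, and the node itself for all
other nodes. -/
def label (κ : Fin (2 ^ n) → K) : Node n → Node n ⊕ K
  | .tree j => if h : 2 ^ n ≤ (j : ℕ) then .inr (κ ⟨j - 2 ^ n, by have := j.2; omega⟩)
      else .inl (.tree j)
  | u => .inl u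

/-- The labels of the two ends of a long edge. -/
def LongEdge.ends (κ : Fin (2 ^ n) → K) (e : LongEdge n) : Sym2 (Node n ⊕ K) :=
  s(label κ e.src, label κ e.tgt)

theorem label_leaf (i : Fin (2 ^ n)) : label κ (.leaf i) = .inr (κ i) := by
  simp [label, Node.leaf]

theorem label_apex : label κ .apex = .inl .apex := by
  simp [label, Node.apex]

/-- A connected set of long edges that leads from the label `ℓ` to vertex `c` of the right clique
through the labels in `S`. -/
structure RightPath (κ : Fin (2 ^ n) → K) (S : Set (Node n ⊕ K)) (ℓ : Node n ⊕ K) (c : Fin 3)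
    (A : Set (LongEdge n)) : Prop where
  preconnected : ((shareGraph (LongEdge.ends κ)).induce A).Preconnected
  mem_labels : ℓ ∈ labels (LongEdge.ends κ) A
  attach_mem : .attach true c ∈ A
  labels_subset : labels (LongEdge.ends κ) A ⊆ insert (.inl (.hub true (c.castLE (by norm_num)))) S

namespace RightPath

theorem mono (h : RightPath κ S ℓ c A) (hS : S ⊆ S') : RightPath κ S' ℓ c A :=
  { h with labels_subset := h.labels_subset.trans (Set.insert_subset_insert hS) }

theorem insert {e : LongEdge n} (h : RightPath κ S ℓ c A) (he : e.ends κ = s(ℓ', ℓ))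
    (hS : S ⊆ S') (hℓ' : ℓ' ∈ S') : RightPath κ S' ℓ' c (insert e A) where
  preconnected := preconnected_shareGraph_insert h.preconnected h.mem_labels
    (he ▸ Sym2.mem_mk_right ℓ' ℓ)
  mem_labels := by
    rw [labels_insert he]
    exact Or.inl rfl
  attach_mem := Or.inr h.attach_mem
  labels_subset := by
    rw [labels_insert_of_mem he h.mem_labels]
    exact Set.insert_subset (Or.inr hℓ') (h.mono hS).labels_subset

end RightPath

theorem ends_attach (s : Bool) (c : Fin 3) : (LongEdge.attach s c).ends κ =
    s(.inl (.hub s (c.castLE (by norm_num))), label κ (terminal s c)) := rfl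

theorem rightPath_attach (c : Fin 3) :
    RightPath κ {label κ (terminal true c)} (label κ (terminal true c)) c {.attach true c} where
  preconnected := preconnected_induce_singleton _
  mem_labels := ⟨_, rfl, Sym2.mem_mk_right _ _⟩
  attach_mem := rfl
  labels_subset := (labels_singleton (ends_attach true c)).subset

/-- The labels of the nodes in column `i` or further to the right. -/
def lineLabels (κ : Fin (2 ^ n) → K) (i : Fin (2 ^ n)) : Set (Node n ⊕ K) :=
  {ℓ | ∃ j ≥ i, ℓ = .inl (.row j) ∨ ℓ = .inr (κ j)}

/-- Two disjoint connections in the columns from `i` on, starting at the label `k` and at `row i`,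
and leading to the vertices `σ 0` and `σ 1` of the right clique. -/
structure RightPathPair (κ : Fin (2 ^ n) → K) (i : Fin (2 ^ n)) (k : K) (σ : Equiv.Perm (Fin 3))
    (A B : Set (LongEdge n)) : Prop where
  left : RightPath κ (lineLabels κ i) (.inr k) (σ 0) A
  right : RightPath κ (lineLabels κ i) (.inl (.row i)) (σ 1) B
  disjoint : Disjoint (labels (LongEdge.ends κ) A) (labels (LongEdge.ends κ) B)
  map_two : σ 2 = 2

theorem rightPathPair_endCol : RightPathPair κ (endCol true) (κ (endCol true)) 1
    {.attach true 0} {.attach true 1} where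
  left := by
    refine label_leaf (κ := κ) _ ▸ (rightPath_attach 0).mono (Set.singleton_subset_iff.2 ?_)
    exact ⟨_, le_rfl, Or.inr (label_leaf _)⟩
  right := (rightPath_attach 1).mono (Set.singleton_subset_iff.2 ⟨_, le_rfl, Or.inl rfl⟩)
  disjoint := by
    rw [labels_singleton (ends_attach true 0), labels_singleton (ends_attach true 1),
      show label κ (terminal true 0) = .inr (κ (endCol true)) from label_leaf _,
      show label κ (terminal true 1) = .inl (.row (endCol true)) from rfl]
    simp
  map_two := rfl

namespace RightPathPair

variable {σ : Equiv.Perm (Fin 3)} {i : Fin (2 ^ n - 1)}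

theorem lineLabels_colR_subset : lineLabels κ (colR i) ⊆ lineLabels κ (colL i) := by
  rintro ℓ ⟨j, hj, hℓ⟩
  exact ⟨j, (show colL i ≤ colR i from Nat.le_succ _).trans hj, hℓ⟩

theorem row_mem_lineLabels (i : Fin (2 ^ n)) : .inl (.row i) ∈ lineLabels κ i :=
  ⟨i, le_rfl, Or.inl rfl⟩

theorem row_colL_notMem (h : RightPath κ (lineLabels κ (colR i)) ℓ c A) :
    .inl (.row (colL i)) ∉ labels (LongEdge.ends κ) A := fun hmem => by
  rcases h.labels_subset hmem with h | ⟨j, hj, h | h⟩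
  · cases h
  · cases h
    exact absurd hj (Nat.not_succ_le_self _)
  · cases h

theorem inr_notMem (h : RightPath κ (lineLabels κ (colR i)) ℓ c A)
    (hk : k ∉ κ '' Set.Ici (colR i)) :
    .inr k ∉ labels (LongEdge.ends κ) A := fun hmem => by
  rcases h.labels_subset hmem with h | ⟨j, hj, h | h⟩
  · cases h
  · cases h
  · exact hk ⟨j, hj, (Sum.inr_injective h).symm⟩

theorem straight (h : RightPathPair κ (colR i) k σ A B) :
    RightPathPair κ (colL i) k σ A (insert (.rowRow i) B) where
  left := h.left.mono lineLabels_colR_subset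
  right := h.right.insert rfl lineLabels_colR_subset (row_mem_lineLabels _)
  disjoint := by
    rw [labels_insert_of_mem (ends := LongEdge.ends κ) (e := .rowRow i) (x := .inl (.row (colL i)))
      rfl h.right.mem_labels, Set.disjoint_insert_right]
    exact ⟨row_colL_notMem h.left, h.disjoint⟩
  map_two := h.map_two

theorem cross (h : RightPathPair κ (colR i) (κ (colR i)) σ A B)
    (hi : κ (colL i) ∉ κ '' Set.Ici (colR i)) :
    RightPathPair κ (colL i) (κ (colL i)) (σ * Equiv.swap 0 1)
      (insert (.leafRow i) B) (insert (.rowLeaf i) A) := by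
  have ends_leafRow : (LongEdge.leafRow i).ends κ = s(.inr (κ (colL i)), .inl (.row (colR i))) :=
    congrArg (s(·, _)) (label_leaf _)
  have ends_rowLeaf : (LongEdge.rowLeaf i).ends κ = s(.inl (.row (colL i)), .inr (κ (colR i))) :=
    congrArg (s(_, ·)) (label_leaf _)
  constructor
  · exact h.right.insert ends_leafRow lineLabels_colR_subset ⟨_, le_rfl, Or.inr rfl⟩
  · exact h.left.insert ends_rowLeaf lineLabels_colR_subset (row_mem_lineLabels _)
  · rw [labels_insert_of_mem ends_leafRow h.right.mem_labels,
      labels_insert_of_mem ends_rowLeaf h.left.mem_labels, Set.disjoint_insert_left,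
      Set.disjoint_insert_right, Set.mem_insert_iff, not_or]
    exact ⟨⟨Sum.inr_ne_inl, inr_notMem h.left hi⟩, row_colL_notMem h.right, h.disjoint.symm⟩
  · exact h.map_two

end RightPathPair

/-- By induction from right to left: the path at label `k` waits as long as `k` still occurs further
to the right, and the two paths change places at the last occurrence of `k`. -/
theorem exists_rightPathPair (m : ℕ) : ∀ i : Fin (2 ^ n), (i : ℕ) + m + 1 = 2 ^ n →
    ∀ k ∈ κ '' Set.Ici i, ∃ σ A B, RightPathPair κ i k σ A B := by
  induction m with
  | zero =>
    rintro i hi _ ⟨j, hj, rfl⟩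
    obtain rfl : i = endCol true := Fin.ext (by simp [endCol]; omega)
    obtain rfl : endCol true = j := hj.antisymm (Fin.le_def.2 (by have := j.2; omega))
    exact ⟨_, _, _, rightPathPair_endCol⟩
  | succ m ih =>
    rintro i hi _ ⟨j, hj, rfl⟩
    obtain ⟨i, rfl⟩ : ∃ i', i = colL i' := ⟨⟨i, by omega⟩, rfl⟩
    have hi' : (colR i : ℕ) + m + 1 = 2 ^ n := by
      simp only [colL, colR] at hi ⊢
      omega
    by_cases hk : κ j ∈ κ '' Set.Ici (colR i)
    · obtain ⟨σ, A, B, h⟩ := ih _ hi' _ hk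
      exact ⟨_, _, _, h.straight⟩
    · obtain ⟨σ, A, B, h⟩ := ih _ hi' _ ⟨_, Set.self_mem_Ici, rfl⟩
      obtain rfl : colL i = j := hj.antisymm (not_lt.1 fun hlt => hk ⟨j, hlt, rfl⟩)
      exact ⟨_, _, _, h.cross hk⟩

theorem lineLabels_subset (i : Fin (2 ^ n)) : lineLabels κ i ⊆ label κ '' middle := by
  rintro _ ⟨j, -, rfl | rfl⟩
  exacts [⟨.row j, Or.inr ⟨_, rfl⟩, rfl⟩, ⟨.leaf j, Or.inl ⟨_, rfl⟩, label_leaf j⟩]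

theorem RightPath.disjoint_labels_attach_two (h : RightPath κ (lineLabels κ i) ℓ c A)
    (hc : c ≠ 2) :
    Disjoint (labels (LongEdge.ends κ) A) (labels (LongEdge.ends κ) {.attach true 2}) := by
  have labels_attach_two : labels (LongEdge.ends κ) {.attach true 2} =
      {.inl (.hub true 2), .inl .apex} := by
    rw [labels_singleton (ends_attach true 2), ← label_apex (κ := κ)]
    rfl
  rw [labels_attach_two]
  refine Set.disjoint_left.2 fun ℓ' hℓ' hmem => ?_
  rcases h.labels_subset hℓ' with rfl | ⟨j, -, rfl | rfl⟩
  · rcases hmem with h | h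
    · exact hc (Fin.castLE_injective _ (Node.hub.inj (Sum.inl_injective h)).2)
    · cases h
  · rcases hmem with h | h <;> cases h
  · rcases hmem with h | h <;> cases h

theorem exists_three_rightPaths (κ : Fin (2 ^ n) → K) :
    ∃ (σ : Equiv.Perm (Fin 3)) (A : Fin 3 → Set (LongEdge n)),
      (∀ c, RightPath κ (label κ '' middle) (label κ (terminal false c)) (σ c) (A c)) ∧
      Pairwise (Function.onFun Disjoint fun c => labels (LongEdge.ends κ) (A c)) := by
  obtain ⟨σ, A, B, h⟩ := exists_rightPathPair (κ := κ) (2 ^ n - 1) (endCol false)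
    (by have : 0 < 2 ^ n := by positivity
        simp [endCol]
        omega) _ ⟨_, Set.self_mem_Ici, rfl⟩
  have ne_two : ∀ {c}, c ≠ 2 → σ c ≠ 2 := fun hc => h.map_two ▸ σ.injective.ne hc
  refine ⟨σ, ![A, B, {.attach true 2}], fun c => ?_, ?_⟩
  · fin_cases c
    · exact label_leaf (κ := κ) _ ▸ h.left.mono (lineLabels_subset _)
    · exact h.right.mono (lineLabels_subset _)
    · exact h.map_two.symm ▸ (rightPath_attach 2).mono
        (Set.singleton_subset_iff.2 ⟨_, Or.inl ⟨_, rfl⟩, rfl⟩)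
  · have hA2 := h.left.disjoint_labels_attach_two (ne_two (by decide))
    have hB2 := h.right.disjoint_labels_attach_two (ne_two (by decide))
    intro c d hcd
    fin_cases c <;> fin_cases d
    exacts [absurd rfl hcd, h.disjoint, hA2, h.disjoint.symm, absurd rfl hcd, hB2, hA2.symm,
      hB2.symm, absurd rfl hcd]

/-- A connected set of long edges that leads from vertex `p false` of the left clique to vertex
`p true` of the right clique through the nodes between the cliques. -/
structure IsConnection (κ : Fin (2 ^ n) → K) (p : Bool → Fin 15) (A : Set (LongEdge n)) :
    Prop where
  preconnected : ((shareGraph (LongEdge.ends κ)).induce A).Preconnected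
  hub_mem : ∀ s, .inl (.hub s (p s)) ∈ labels (LongEdge.ends κ) A
  labels_subset : labels (LongEdge.ends κ) A ⊆
    (Set.range fun s => .inl (.hub s (p s))) ∪ label κ '' middle

theorem isConnection_insert
    (h : RightPath κ (label κ '' middle) (label κ (terminal false c)) d A) :
    IsConnection κ (fun s => (bif s then d else c).castLE (by norm_num))
      (insert (.attach false c) A) where
  preconnected := preconnected_shareGraph_insert h.preconnected h.mem_labels
    (Sym2.mem_mk_right _ _)
  hub_mem
    | false => ⟨_, Or.inl rfl, Sym2.mem_mk_left _ _⟩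
    | true => ⟨_, Or.inr h.attach_mem, Sym2.mem_mk_left _ _⟩
  labels_subset := by
    rw [labels_insert_of_mem (ends_attach false c) h.mem_labels]
    refine Set.insert_subset (Or.inl ⟨false, rfl⟩) (h.labels_subset.trans ?_)
    exact Set.insert_subset (Or.inl ⟨true, rfl⟩) Set.subset_union_right

theorem inl_hub_notMem_label_image_middle (s : Bool) (i : Fin 15) :
    .inl (.hub s i) ∉ label κ '' middle := by
  rintro ⟨_, ⟨j, rfl⟩ | ⟨j, rfl⟩, h⟩
  · rw [label] at h
    split at h <;> cases h
  · cases h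

theorem inl_port_notMem_label_image_middle (s : Bool) (i j : Fin 15) :
    .inl (.port s i j) ∉ label κ '' middle := by
  rintro ⟨_, ⟨j, rfl⟩ | ⟨j, rfl⟩, h⟩
  · rw [label] at h
    split at h <;> cases h
  · cases h

theorem RightPath.inl_hub_false_notMem (h : RightPath κ (label κ '' middle) ℓ c A) (i : Fin 15) :
    .inl (.hub false i) ∉ labels (LongEdge.ends κ) A := fun hmem => by
  rcases h.labels_subset hmem with h | h
  · cases h
  · exact inl_hub_notMem_label_image_middle false i h

theorem exists_three_connections (κ : Fin (2 ^ n) → K) :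
    ∃ (ρ : Bool → Equiv.Perm (Fin 15)) (A : Fin 3 → Set (LongEdge n)),
      (∀ c, IsConnection κ (fun s => ρ s (c.castLE (by norm_num))) (A c)) ∧
      Pairwise (Function.onFun Disjoint fun c => labels (LongEdge.ends κ) (A c)) := by
  obtain ⟨σ, A, hA, disjoint⟩ := exists_three_rightPaths κ
  let ρ : Bool → Equiv.Perm (Fin 15) := fun s =>
    bif s then σ.viaFintypeEmbedding (Fin.castLEEmb (by norm_num)) else 1
  have ρ_castLE : ∀ c s, ρ s (c.castLE (by norm_num)) =
      (bif s then σ c else c).castLE (by norm_num)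
    | c, false => rfl
    | c, true => σ.viaFintypeEmbedding_apply_image (Fin.castLEEmb (by norm_num)) c
  refine ⟨ρ, fun c => insert (.attach false c) (A c), fun c => ?_, fun c d hcd => ?_⟩
  · simp only [ρ_castLE]
    exact isConnection_insert (hA c)
  · simp only [Function.onFun, labels_insert_of_mem (ends_attach false _) (hA _).mem_labels,
      Set.disjoint_insert_left, Set.disjoint_insert_right, Set.mem_insert_iff, Sum.inl.injEq,
      Node.hub.injEq, (Fin.castLE_injective _).eq_iff, (hA _).inl_hub_false_notMem, or_false,
      true_and, not_false_eq_true]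
    exact ⟨hcd.symm, disjoint hcd⟩

end RightPaths

section LabelModel

/-- A model of `H` in which branch sets and edge sets are sets of edges of a multigraph. Edges with
equal labels at an end are treated as sharing that end, and sets of edges that do not belong
together have no label in common. -/
structure IsLabelModel {α E Λ : Type*} (H : SimpleGraph α) (ends : E → Sym2 Λ) (B : α → Set E)
    (P : H.edgeSet → Set E) : Prop where
  connected_branch : ∀ v, ((shareGraph ends).induce (B v)).Connected
  connected_edge : ∀ e, ((shareGraph ends).induce (P e)).Connected
  meet : ∀ v (e : H.edgeSet), v ∈ (e : Sym2 α) → (labels ends (B v) ∩ labels ends (P e)).Nonempty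
  disjoint_branch : ∀ u v, u ≠ v → Disjoint (labels ends (B u)) (labels ends (B v))
  disjoint_edge : ∀ e f, e ≠ f → Disjoint (labels ends (P e)) (labels ends (P f))
  disjoint_branch_edge : ∀ v (e : H.edgeSet), v ∉ (e : Sym2 α) →
    Disjoint (labels ends (B v)) (labels ends (P e))

theorem cliqueHom_inj {s t : Bool} {i j : Fin 15} (h : cliqueHom s i = cliqueHom t j) :
    s = t ∧ i = j := by
  cases s <;> cases t <;> cases h <;> exact ⟨rfl, rfl⟩

theorem exists_eq_cliqueHom : ∀ v : Fin 15 ⊕ Fin 15, ∃ s i, v = cliqueHom s i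
  | .inl i => ⟨false, i, rfl⟩
  | .inr i => ⟨true, i, rfl⟩

theorem exists_eq_cliqueHom_or_eq_crossEdge (e : linkedK15.edgeSet) :
    (∃ s i j, (e : Sym2 _) = s(cliqueHom s i, cliqueHom s j)) ∨ ∃ c, e = crossEdge c := by
  obtain ⟨e, he⟩ := e
  induction e using Sym2.ind with | _ u v =>
  rcases u with i | i <;> rcases v with j | j
  · exact Or.inl ⟨false, i, j, rfl⟩
  · obtain ⟨rfl, hi⟩ := he
    exact Or.inr ⟨⟨i, hi⟩, rfl⟩
  · obtain ⟨rfl, hi⟩ := he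
    exact Or.inr ⟨⟨i, hi⟩, Subtype.ext Sym2.eq_swap⟩
  · exact Or.inl ⟨true, i, j, rfl⟩

theorem cliqueHom_mem_crossEdge (s : Bool) (c : Fin 3) :
    cliqueHom s (c.castLE (by norm_num)) ∈ (crossEdge c : Sym2 (Fin 15 ⊕ Fin 15)) := by
  cases s
  exacts [Sym2.mem_mk_left _ _, Sym2.mem_mk_right _ _]

theorem eq_of_cliqueHom_mem_crossEdge {s : Bool} {i : Fin 15} {c : Fin 3}
    (h : cliqueHom s i ∈ (crossEdge c : Sym2 (Fin 15 ⊕ Fin 15))) :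
    i = c.castLE (by norm_num) := by
  cases s <;> rcases Sym2.mem_iff.1 h with h | h <;> cases h <;> rfl

theorem crossEdge_ne (s : Bool) (i j : Fin 15) (c : Fin 3) :
    (crossEdge c : Sym2 (Fin 15 ⊕ Fin 15)) ≠ s(cliqueHom s i, cliqueHom s j) := fun h => by
  have mem := h ▸ cliqueHom_mem_crossEdge (!s) c
  rcases Sym2.mem_iff.1 mem with h | h <;> exact (Bool.not_ne_self s) (cliqueHom_inj h).1

theorem crossEdge_injective : Function.Injective crossEdge := fun c _ h =>
  Fin.castLE_injective _ (eq_of_cliqueHom_mem_crossEdge (h ▸ cliqueHom_mem_crossEdge false c))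

variable {n : ℕ} {K : Type*} {κ : Fin (2 ^ n) → K} {ℓ : Node n ⊕ K}
  {ρ : Bool → Equiv.Perm (Fin 15)} {A : Fin 3 → Set (LongEdge n)} {v : Fin 15 ⊕ Fin 15}
  {e : linkedK15.edgeSet}

/-- The long edges at the vertex of the construction that represents the vertex `v` of `linkedK15`,
where vertex `i` of clique `s` is represented by `hub s (ρ s i)`. -/
def branchPart (ρ : Bool → Equiv.Perm (Fin 15)) (v : Fin 15 ⊕ Fin 15) : Set (LongEdge n) :=
  {f | ∃ s i j, v = cliqueHom s i ∧ f = .hubPort s (ρ s i) j}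

/-- The long edges that represent the edge `e` of `linkedK15`, where `A c` represents the edge
`crossEdge c`. -/
def edgePart (ρ : Bool → Equiv.Perm (Fin 15)) (A : Fin 3 → Set (LongEdge n))
    (e : linkedK15.edgeSet) : Set (LongEdge n) :=
  {f | (∃ s i j, (e : Sym2 _) = s(cliqueHom s i, cliqueHom s j) ∧
    f = .portPort s (ρ s i) (ρ s j)) ∨ ∃ c, e = crossEdge c ∧ f ∈ A c}

theorem edgePart_crossEdge (c : Fin 3) : edgePart ρ A (crossEdge c) = A c := by
  ext f
  constructor
  · rintro (⟨s, i, j, he, -⟩ | ⟨d, he, hf⟩)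
    · exact absurd he (crossEdge_ne s i j c)
    · exact crossEdge_injective he ▸ hf
  · exact fun hf => Or.inr ⟨c, rfl, hf⟩

theorem exists_of_mem_labels_branchPart
    (hℓ : ℓ ∈ labels (LongEdge.ends κ) (branchPart ρ v)) :
    ∃ s i, v = cliqueHom s i ∧ (ℓ = .inl (.hub s (ρ s i)) ∨ ∃ j, ℓ = .inl (.port s (ρ s i) j)) := by
  obtain ⟨_, ⟨s, i, j, hv, rfl⟩, hℓ⟩ := hℓ
  exact ⟨s, i, hv, (Sym2.mem_iff.1 hℓ).imp id fun h => ⟨j, h⟩⟩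

theorem exists_of_mem_labels_edgePart (hℓ : ℓ ∈ labels (LongEdge.ends κ) (edgePart ρ A e)) :
    (∃ s i j, (e : Sym2 _) = s(cliqueHom s i, cliqueHom s j) ∧
      ℓ = .inl (.port s (ρ s i) (ρ s j))) ∨
    ∃ c, e = crossEdge c ∧ ℓ ∈ labels (LongEdge.ends κ) (A c) := by
  obtain ⟨f, ⟨s, i, j, he, rfl⟩ | ⟨c, he, hf⟩, hℓ⟩ := hℓ
  · rcases Sym2.mem_iff.1 hℓ with rfl | rfl
    exacts [Or.inl ⟨s, i, j, he, rfl⟩, Or.inl ⟨s, j, i, he.trans Sym2.eq_swap, rfl⟩]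
  · exact Or.inr ⟨c, he, f, hf, hℓ⟩

theorem connected_branchPart (κ : Fin (2 ^ n) → K) (ρ : Bool → Equiv.Perm (Fin 15))
    (v : Fin 15 ⊕ Fin 15) :
    ((shareGraph (LongEdge.ends κ)).induce (branchPart ρ v)).Connected := by
  obtain ⟨s, i, rfl⟩ := exists_eq_cliqueHom v
  refine SimpleGraph.connected_iff _ |>.2 ⟨?_, ⟨.hubPort s (ρ s i) 0, s, i, 0, rfl, rfl⟩⟩
  refine preconnected_shareGraph_of_forall_mem (ℓ := .inl (.hub s (ρ s i))) ?_
  rintro _ ⟨t, j, k, hij, rfl⟩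
  obtain ⟨rfl, rfl⟩ := cliqueHom_inj hij
  exact Sym2.mem_mk_left _ _

theorem inl_port_mem_ends_of_mem_edgePart {s : Bool} {i j : Fin 15} {f : LongEdge n}
    (he : (e : Sym2 _) = s(cliqueHom s i, cliqueHom s j)) (hf : f ∈ edgePart ρ A e) :
    .inl (.port s (ρ s i) (ρ s j)) ∈ f.ends κ := by
  rcases hf with ⟨t, k, l, he', rfl⟩ | ⟨c, rfl, -⟩
  · rcases Sym2.eq_iff.1 (he.symm.trans he') with ⟨h, h'⟩ | ⟨h, h'⟩ <;>
      obtain ⟨rfl, rfl⟩ := cliqueHom_inj h <;> obtain ⟨-, rfl⟩ := cliqueHom_inj h'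
    exacts [Sym2.mem_mk_left _ _, Sym2.mem_mk_right _ _]
  · exact absurd he (crossEdge_ne s i j c)

theorem connected_edgePart
    (hA : ∀ c, IsConnection κ (fun s => ρ s (c.castLE (by norm_num))) (A c))
    (e : linkedK15.edgeSet) :
    ((shareGraph (LongEdge.ends κ)).induce (edgePart ρ A e)).Connected := by
  rw [SimpleGraph.connected_iff]
  rcases exists_eq_cliqueHom_or_eq_crossEdge e with ⟨s, i, j, he⟩ | ⟨c, rfl⟩
  · exact ⟨preconnected_shareGraph_of_forall_mem fun f hf =>
      inl_port_mem_ends_of_mem_edgePart he hf, ⟨_, Or.inl ⟨s, i, j, he, rfl⟩⟩⟩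
  · obtain ⟨f, hf, -⟩ := (hA c).hub_mem true
    rw [edgePart_crossEdge]
    exact ⟨(hA c).preconnected, ⟨f, hf⟩⟩

theorem labels_branchPart_inter_labels_edgePart_nonempty
    (hA : ∀ c, IsConnection κ (fun s => ρ s (c.castLE (by norm_num))) (A c))
    (hv : v ∈ (e : Sym2 _)) :
    (labels (LongEdge.ends κ) (branchPart ρ v) ∩
      labels (LongEdge.ends κ) (edgePart ρ A e)).Nonempty := by
  rcases exists_eq_cliqueHom_or_eq_crossEdge e with ⟨s, i, j, he⟩ | ⟨c, rfl⟩
  · obtain ⟨k, l, rfl, he⟩ : ∃ k l, v = cliqueHom s k ∧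
        (e : Sym2 _) = s(cliqueHom s k, cliqueHom s l) := by
      rcases Sym2.mem_iff.1 (he ▸ hv) with rfl | rfl
      exacts [⟨i, j, rfl, he⟩, ⟨j, i, rfl, he.trans Sym2.eq_swap⟩]
    exact ⟨.inl (.port s (ρ s k) (ρ s l)),
      ⟨.hubPort s (ρ s k) (ρ s l), ⟨s, k, _, rfl, rfl⟩, Sym2.mem_mk_right _ _⟩,
      ⟨.portPort s (ρ s k) (ρ s l), Or.inl ⟨s, k, l, he, rfl⟩, Sym2.mem_mk_left _ _⟩⟩
  · obtain ⟨s, i, rfl⟩ := exists_eq_cliqueHom v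
    obtain rfl := eq_of_cliqueHom_mem_crossEdge hv
    rw [edgePart_crossEdge]
    exact ⟨_, ⟨.hubPort s _ 0, ⟨s, _, 0, rfl, rfl⟩, Sym2.mem_mk_left _ _⟩, (hA c).hub_mem s⟩

theorem disjoint_labels_branchPart {u v : Fin 15 ⊕ Fin 15} (huv : u ≠ v) :
    Disjoint (labels (LongEdge.ends κ) (branchPart ρ u))
      (labels (LongEdge.ends κ) (branchPart ρ v)) := by
  refine Set.disjoint_left.2 fun ℓ hu hv => huv ?_
  obtain ⟨s, i, rfl, hℓ⟩ := exists_of_mem_labels_branchPart hu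
  obtain ⟨t, j, rfl, hℓ'⟩ := exists_of_mem_labels_branchPart hv
  obtain ⟨rfl, h⟩ : s = t ∧ ρ s i = ρ t j := by
    rcases hℓ with rfl | ⟨_, rfl⟩ <;> rcases hℓ' with h | ⟨_, h⟩
    · exact Node.hub.inj (Sum.inl_injective h)
    · cases h
    · cases h
    · exact (Node.port.inj (Sum.inl_injective h)).imp_right And.left
  rw [(ρ s).injective h]

theorem IsConnection.inl_port_notMem {p : Bool → Fin 15} {A : Set (LongEdge n)}
    (h : IsConnection κ p A) (s : Bool) (i j : Fin 15) :
    .inl (.port s i j) ∉ labels (LongEdge.ends κ) A := fun hmem => by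
  rcases h.labels_subset hmem with ⟨t, ht⟩ | hmem
  · cases ht
  · exact inl_port_notMem_label_image_middle s i j hmem

theorem IsConnection.eq_of_inl_hub_mem {p : Bool → Fin 15} {A : Set (LongEdge n)}
    (h : IsConnection κ p A) {s : Bool} {i : Fin 15}
    (hmem : .inl (.hub s i) ∈ labels (LongEdge.ends κ) A) : i = p s := by
  rcases h.labels_subset hmem with ⟨t, ht⟩ | hmem
  · cases ht
    rfl
  · exact absurd hmem (inl_hub_notMem_label_image_middle s i)

theorem disjoint_labels_edgePart
    (hA : ∀ c, IsConnection κ (fun s => ρ s (c.castLE (by norm_num))) (A c))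
    (disjoint : Pairwise (Function.onFun Disjoint fun c => labels (LongEdge.ends κ) (A c)))
    {e f : linkedK15.edgeSet} (hef : e ≠ f) :
    Disjoint (labels (LongEdge.ends κ) (edgePart ρ A e))
      (labels (LongEdge.ends κ) (edgePart ρ A f)) := by
  refine Set.disjoint_left.2 fun ℓ he hf => hef ?_
  rcases exists_of_mem_labels_edgePart he with ⟨s, i, j, he_eq, rfl⟩ | ⟨c, rfl, hc⟩ <;>
    rcases exists_of_mem_labels_edgePart hf with ⟨t, k, l, hf_eq, h⟩ | ⟨d, rfl, hd⟩
  · obtain ⟨rfl, hik, hjl⟩ := Node.port.inj (Sum.inl_injective h)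
    rw [← (ρ s).injective hik, ← (ρ s).injective hjl] at hf_eq
    exact Subtype.ext (he_eq.trans hf_eq.symm)
  · exact absurd hd ((hA d).inl_port_notMem _ _ _)
  · exact absurd (h ▸ hc) ((hA c).inl_port_notMem _ _ _)
  · exact congrArg crossEdge (not_not.1 fun hcd => (disjoint hcd).notMem_of_mem_left hc hd)

theorem disjoint_labels_branchPart_edgePart
    (hA : ∀ c, IsConnection κ (fun s => ρ s (c.castLE (by norm_num))) (A c))
    (hv : v ∉ (e : Sym2 _)) :
    Disjoint (labels (LongEdge.ends κ) (branchPart ρ v))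
      (labels (LongEdge.ends κ) (edgePart ρ A e)) := by
  refine Set.disjoint_left.2 fun ℓ hℓv hℓe => hv ?_
  obtain ⟨s, i, rfl, hℓ⟩ := exists_of_mem_labels_branchPart hℓv
  rcases exists_of_mem_labels_edgePart hℓe with ⟨t, j, k, he, rfl⟩ | ⟨c, rfl, hc⟩
  · rcases hℓ with h | ⟨_, h⟩
    · cases h
    · obtain ⟨rfl, hij, -⟩ := Node.port.inj (Sum.inl_injective h)
      rw [← (ρ t).injective hij, he]
      exact Sym2.mem_mk_left _ _
  · rcases hℓ with rfl | ⟨_, rfl⟩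
    · rw [(ρ s).injective ((hA c).eq_of_inl_hub_mem hc)]
      exact cliqueHom_mem_crossEdge s c
    · exact absurd hc ((hA c).inl_port_notMem _ _ _)

theorem exists_isLabelModel (κ : Fin (2 ^ n) → K) :
    ∃ B P, IsLabelModel linkedK15 (LongEdge.ends κ) B P := by
  obtain ⟨ρ, A, hA, disjoint⟩ := exists_three_connections κ
  exact ⟨branchPart ρ, edgePart ρ A, {
    connected_branch := connected_branchPart κ ρ
    connected_edge := connected_edgePart hA
    meet := fun _ _ hv => labels_branchPart_inter_labels_edgePart_nonempty hA hv
    disjoint_branch := fun _ _ huv => disjoint_labels_branchPart huv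
    disjoint_edge := fun _ _ hef => disjoint_labels_edgePart hA disjoint hef
    disjoint_branch_edge := fun _ _ hv => disjoint_labels_branchPart_edgePart hA hv }⟩

end LabelModel

section CapDist

variable {N E : Type*} {T : SimpleGraph N} {S : Set N} {src tgt : E → N} {L d m : ℕ} {e f : E}
  {u v : N} {z z' : N ⊕ E × Fin L}

/-- The distance to the set `S`, capped at `m`. -/
noncomputable def capDist (T : SimpleGraph N) (m : ℕ) (S : Set N) (u : N) : ℕ :=
  (min (m : ℕ∞) (setDist T {u} S)).toNat

theorem le_capDist_iff {k : ℕ} :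
    k ≤ capDist T m S u ↔ k ≤ m ∧ ∀ v ∈ S, (k : ℕ∞) ≤ T.edist u v := by
  have coe_capDist : (capDist T m S u : ℕ∞) = min (m : ℕ∞) (setDist T {u} S) :=
    ENat.natCast_toNat (ne_top_of_le_ne_top (ENat.natCast_ne_top m) (min_le_left _ _))
  rw [← Nat.cast_le (α := ℕ∞), coe_capDist, le_min_iff, le_setDist_iff, Nat.cast_le]
  simp

theorem capDist_le (m : ℕ) (S : Set N) (u : N) : capDist T m S u ≤ m :=
  (le_capDist_iff.1 le_rfl).1

theorem capDist_of_mem (hu : u ∈ S) : capDist T m S u = 0 := by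
  simpa using (le_capDist_iff.1 (le_refl (capDist T m S u))).2 u hu

theorem capDist_le_capDist_add_one (h : T.Adj u v) : capDist T m S u ≤ capDist T m S v + 1 := by
  obtain ⟨le_m, le_edist⟩ := le_capDist_iff.1 (le_refl (capDist T m S u))
  refine Nat.sub_le_iff_le_add.1 (le_capDist_iff.2 ⟨by omega, fun w hw => ?_⟩)
  rw [ENat.natCast_sub, Nat.cast_one, tsub_le_iff_left]
  refine (le_edist w hw).trans ((SimpleGraph.edist_triangle (v := v)).trans ?_)
  rw [SimpleGraph.edist_eq_one_iff_adj.2 h]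

theorem exists_edist_le_of_capDist_le (hd : d < m) (h : capDist T m S u ≤ d) :
    ∃ v ∈ S, T.edist u v ≤ d := by
  by_contra! hn
  refine (le_capDist_iff.2 ⟨hd, fun v hv => ?_⟩).not_gt (Nat.lt_succ_of_le h)
  exact_mod_cast Order.add_one_le_of_lt (hn v hv)

theorem exists_end_near {I : Set E} (hd : d < L) (hI : ∀ e ∈ I, src e ∈ S ∧ tgt e ∈ S)
    (he : e ∉ I) (hz : z ∈ closedPath src tgt L e)
    (hz' : extend src tgt L I (capDist T (d + 1) S) z' = 0)
    (h : (addPaths T src tgt L).edist z z' ≤ d) :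
    ∃ u ∈ s(src e, tgt e), ∃ v ∈ S, T.edist u v ≤ d := by
  have extend_le : extend src tgt L I (capDist T (d + 1) S) z ≤ d := by
    have := le_add_edist_of_forall_adj (G := addPaths T src tgt L) (extend_le_extend_add_one
      (S := I) (fun u => (capDist_le (d + 1) S u).trans hd) (fun _ _ => capDist_le_capDist_add_one)
      fun e he => ⟨capDist_of_mem (hI e he).1, capDist_of_mem (hI e he).2⟩) z z'
    rw [hz', Nat.cast_zero, zero_add] at this
    exact_mod_cast this.trans h
  have capDist_end_le : ∃ u ∈ s(src e, tgt e), capDist T (d + 1) S u ≤ d := by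
    rcases hz with rfl | rfl | ⟨i, rfl⟩
    · exact ⟨_, Sym2.mem_mk_left _ _, extend_le⟩
    · exact ⟨_, Sym2.mem_mk_right _ _, extend_le⟩
    · rw [extend, if_neg he, min_le_iff] at extend_le
      exact extend_le.elim (fun h => ⟨_, Sym2.mem_mk_left _ _, by omega⟩)
        fun h => ⟨_, Sym2.mem_mk_right _ _, by omega⟩
  obtain ⟨u, hu, hle⟩ := capDist_end_le
  exact ⟨u, hu, exists_edist_le_of_capDist_le (Nat.lt_succ_self d) hle⟩

theorem exists_end_near_node (hd : d < L) (hz : z ∈ closedPath src tgt L e)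
    (h : (addPaths T src tgt L).edist z (.inl u) ≤ d) :
    ∃ v ∈ s(src e, tgt e), T.edist v u ≤ d := by
  obtain ⟨v, hv, _, rfl, hvu⟩ := exists_end_near (S := {u}) (I := ∅) hd (by simp)
    (Set.notMem_empty e) hz (by exact capDist_of_mem (Set.mem_singleton u)) h
  exact ⟨v, hv, hvu⟩

theorem exists_ends_near (hd : d < L) (hef : e ≠ f) (hz : z ∈ closedPath src tgt L e)
    (hz' : z' ∈ closedPath src tgt L f) (h : (addPaths T src tgt L).edist z z' ≤ d) :
    ∃ u ∈ s(src e, tgt e), ∃ v ∈ s(src f, tgt f), T.edist u v ≤ d := by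
  refine exists_end_near (S := {v | v ∈ s(src f, tgt f)}) (I := {f}) hd ?_ hef hz ?_ h
  · rintro _ rfl
    exact ⟨Sym2.mem_mk_left _ _, Sym2.mem_mk_right _ _⟩
  · rcases hz' with rfl | rfl | ⟨i, rfl⟩
    · exact capDist_of_mem (Sym2.mem_mk_left (src f) (tgt f))
    · exact capDist_of_mem (Sym2.mem_mk_right (src f) (tgt f))
    · exact if_pos rfl

end CapDist

section QuasiIsometry

variable {V W : Type*} {G : SimpleGraph V} {G' : SimpleGraph W} {φ : V → W} {q m : ℕ}

namespace IsQuasiIsometry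

theorem edist_map_le (h : IsQuasiIsometry q G G' φ) {x y : V} (hm : G.edist x y ≤ m) :
    G'.edist (φ x) (φ y) ≤ (q * m + q : ℕ) := by
  refine ENat.toENNReal_le.1 ((h.upper x y).trans ?_)
  push_cast
  gcongr
  exact_mod_cast ENat.toENNReal_le.2 hm

theorem edist_le (h : IsQuasiIsometry q G G' φ) (hq : 1 ≤ q) {x y : V}
    (hm : G'.edist (φ x) (φ y) ≤ m) : G.edist x y ≤ (q * (m + q) : ℕ) := by
  have lower := tsub_le_iff_right.1 ((h.lower x y).trans (ENat.toENNReal_le.2 hm))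
  rw [ENNReal.inv_mul_le_iff (by simpa using (by omega : q ≠ 0)) (by simp)] at lower
  exact ENat.toENNReal_le.1 (by exact_mod_cast lower)

end IsQuasiIsometry

/-- The vertices of `G'` at distance at most `2 * q` from the image of `Z`. -/
def thick (G' : SimpleGraph W) (φ : V → W) (q : ℕ) (Z : Set V) : Set W :=
  ⋃ z ∈ Z, {w | G'.edist w (φ z) ≤ (2 * q : ℕ)}

theorem mem_thick {Z : Set V} {w : W} :
    w ∈ thick G' φ q Z ↔ ∃ z ∈ Z, G'.edist w (φ z) ≤ (2 * q : ℕ) := by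
  simp only [thick, Set.mem_iUnion, exists_prop, Set.mem_ofPred_eq]

theorem map_mem_thick {Z : Set V} {z : V} (hz : z ∈ Z) : φ z ∈ thick G' φ q Z :=
  mem_thick.2 ⟨z, hz, by simp⟩

namespace IsQuasiIsometry

theorem preconnected_thick (h : IsQuasiIsometry q G G' φ) {Z : Set V}
    (hZ : (G.induce Z).Preconnected) : (G'.induce (thick G' φ q Z)).Preconnected := by
  refine preconnected_induce_biUnion hZ (fun z _ => preconnected_induce_ball _ _)
    fun z _ z' _ hzz' => ⟨φ z', ?_, ?_⟩
  · have := h.edist_map_le (x := z') (y := z) (m := 1)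
      (by rw [SimpleGraph.edist_eq_one_iff_adj.2 hzz'.symm, Nat.cast_one])
    rwa [mul_one, ← two_mul] at this
  · simp

theorem edist_le_of_edist_le_one (h : IsQuasiIsometry q G G' φ) (hq : 1 ≤ q) {w w' : W} {z z' : V}
    (hw : G'.edist w (φ z) ≤ (2 * q : ℕ)) (hw' : G'.edist w' (φ z') ≤ (2 * q : ℕ))
    (hww : G'.edist w w' ≤ 1) : G.edist z z' ≤ (q * (5 * q + 1) : ℕ) := by
  have edist_map_le : G'.edist (φ z) (φ z') ≤ (4 * q + 1 : ℕ) := by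
    calc G'.edist (φ z) (φ z') ≤ G'.edist (φ z) w + (G'.edist w w' + G'.edist w' (φ z')) :=
          SimpleGraph.edist_triangle.trans (add_le_add le_rfl SimpleGraph.edist_triangle)
      _ ≤ (2 * q : ℕ) + (1 + (2 * q : ℕ)) := by
          rw [SimpleGraph.edist_comm] at hw
          gcongr
      _ = (4 * q + 1 : ℕ) := by norm_cast; omega
  have := h.edist_le hq edist_map_le
  rwa [show 4 * q + 1 + q = 5 * q + 1 by omega] at this

end IsQuasiIsometry

end QuasiIsometry

section Depth

variable {n L d : ℕ} {K : Type*} {κ : Fin (2 ^ n) → K} {e : LongEdge n} {u v : Node n}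
  {i : Fin (2 ^ n)} {ℓ : Node n ⊕ K}

/-- The distance to the apex in the tree, with value `0` for the nodes outside the tree. -/
def Node.depth : Node n → ℕ
  | .tree k => Nat.size k
  | _ => 0

theorem Node.depth_le (u : Node n) : u.depth ≤ n + 1 := by
  rcases u with k | _ | _ | _
  · exact Nat.size_le.2 k.2
  all_goals exact Nat.zero_le _

theorem Node.depth_apex : (Node.apex : Node n).depth = 0 := Nat.size_zero

theorem Node.le_depth_leaf (i : Fin (2 ^ n)) : n + 1 ≤ (Node.leaf i).depth :=
  Nat.lt_size.2 (Nat.le_add_right _ _)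

theorem size_le_size_half_add_one (k : ℕ) : Nat.size k ≤ Nat.size (k / 2) + 1 := by
  rw [Nat.size_le, pow_succ]
  have := Nat.lt_size_self (k / 2)
  omega

theorem depth_le_depth_add_one (h : (tree n).Adj u v) : u.depth ≤ v.depth + 1 := by
  rcases u with u | _ | _ | _ <;> rcases v with v | _ | _ | _ <;> try exact h.elim
  change Nat.size u ≤ Nat.size v + 1
  obtain ⟨-, h | h⟩ := h
  · exact h ▸ (Nat.size_le_size (Nat.div_le_self _ _)).trans (Nat.le_succ _)
  · exact h ▸ size_le_size_half_add_one _

theorem depth_le_edist_apex (hL : n + 1 ≤ L) (u : Node n) :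
    (u.depth : ℕ∞) ≤ (fatGraph n L).edist (.inl u) (.inl .apex) := by
  have := le_add_edist_of_forall_adj (G := fatGraph n L) (extend_le_extend_add_one (S := ∅)
    (fun u => u.depth_le.trans hL) (fun _ _ => depth_le_depth_add_one) (by simp))
    (.inl u) (.inl .apex)
  simpa [extend, Node.depth_apex] using this

theorem le_depth_of_edist_leaf_le (h : (tree n).edist u (.leaf i) ≤ d) : n + 1 ≤ u.depth + d := by
  have lipschitz := le_add_edist_of_forall_adj (fun _ _ => depth_le_depth_add_one) (.leaf i) u
  rw [SimpleGraph.edist_comm] at lipschitz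
  exact (Node.le_depth_leaf i).trans (by exact_mod_cast lipschitz.trans (add_le_add le_rfl h))

theorem eq_of_edist_le_of_forall_ne_tree (hu : ∀ k, u ≠ .tree k) (h : (tree n).edist u v ≤ d) :
    u = v := by
  obtain ⟨p⟩ := SimpleGraph.edist_ne_top_iff_reachable.1
    (ne_top_of_le_ne_top (ENat.natCast_ne_top d) h)
  cases p with
  | nil => rfl
  | cons h _ =>
    rcases u with k | _ | _ | _
    · exact absurd rfl (hu k)
    all_goals exact h.elim

theorem eq_apex_or_eq_leaf_or_ne_tree (hu : u ∈ s(e.src, e.tgt)) :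
    u = .apex ∨ (∃ i, u = .leaf i) ∨ ∀ k, u ≠ .tree k := by
  rcases Sym2.mem_iff.1 hu with rfl | rfl
  · rcases e with _ | i | _ | _ | _ | _
    · simp [LongEdge.src]
    · exact Or.inr (Or.inl ⟨_, rfl⟩)
    all_goals simp [LongEdge.src]
  · rcases e with _ | _ | i | _ | _ | ⟨s, c⟩
    · simp [LongEdge.tgt]
    · simp [LongEdge.tgt]
    · exact Or.inr (Or.inl ⟨_, rfl⟩)
    · simp [LongEdge.tgt]
    · simp [LongEdge.tgt]
    · fin_cases c
      exacts [Or.inr (Or.inl ⟨_, rfl⟩), Or.inr (Or.inr nofun), Or.inl rfl]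

theorem label_eq_inl_or_eq_leaf (κ : Fin (2 ^ n) → K) (u : Node n) :
    label κ u = .inl u ∨ ∃ i, u = .leaf i := by
  rcases u with k | _ | _ | _
  · by_cases hk : 2 ^ n ≤ (k : ℕ)
    · exact Or.inr ⟨⟨k - 2 ^ n, by have := k.2; omega⟩, by simp [Node.leaf, hk]⟩
    · exact Or.inl (dif_neg hk)
  all_goals exact Or.inl rfl

theorem eq_or_eq_leaf_of_label_eq (h : label κ u = label κ v) :
    u = v ∨ ∃ i j, u = .leaf i ∧ v = .leaf j ∧ κ i = κ j := by
  rcases label_eq_inl_or_eq_leaf κ u with hu | ⟨i, rfl⟩ <;>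
    rcases label_eq_inl_or_eq_leaf κ v with hv | ⟨j, rfl⟩
  · exact Or.inl (Sum.inl_injective (hu ▸ hv ▸ h))
  · rw [hu, label_leaf] at h
    cases h
  · rw [hv, label_leaf] at h
    cases h
  · rw [label_leaf, label_leaf] at h
    exact Or.inr ⟨i, j, rfl, rfl, Sum.inr_injective h⟩

theorem mem_ends_iff : ℓ ∈ e.ends κ ↔ ∃ u ∈ s(e.src, e.tgt), label κ u = ℓ :=
  Sym2.mem_map (z := s(e.src, e.tgt))

theorem inl_mem_closedPath (hu : u ∈ s(e.src, e.tgt)) :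
    .inl u ∈ closedPath LongEdge.src LongEdge.tgt L e := by
  rcases Sym2.mem_iff.1 hu with rfl | rfl
  exacts [Or.inl rfl, Or.inr (Or.inl rfl)]

end Depth

section Hat

variable {W : Type*} {G' : SimpleGraph W} {n L q : ℕ} {φ : Node n ⊕ LongEdge n × Fin L → W}
  {e f : LongEdge n} {u v : Node n} {i j : Fin (2 ^ n)} {w w' : W} {S S' : Set (LongEdge n)}

/-- A bound for the distance of two vertices whose images have neighborhoods of radius `2 * q` at
distance at most `1`. -/
def reach (q : ℕ) : ℕ := q * (5 * q + 1)

/-- The radius of the ball around the image of the apex that is removed from the image of the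
tree. -/
def radius (q : ℕ) : ℕ := q * reach q + 3 * q

/-- The neighborhood of the image of the tree, outside a ball around the image of the apex. -/
def lowerTree (G' : SimpleGraph W) (q : ℕ) (φ : Node n ⊕ LongEdge n × Fin L → W) : Set W :=
  {w | (∃ k, G'.edist w (φ (.inl (.tree k))) ≤ (2 * q : ℕ)) ∧
    ¬ G'.edist w (φ (.inl .apex)) ≤ (radius q : ℕ)}

/-- The component of `lowerTree` that contains the image of the leaf in column `i`. These components
label the leaves: two long edges ending at leaves in the same component count as adjacent. -/
def leafComp (G' : SimpleGraph W) (q : ℕ) (φ : Node n ⊕ LongEdge n × Fin L → W)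
    (i : Fin (2 ^ n)) : Set W :=
  componentIn G' (lowerTree G' q φ) (φ (.inl (.leaf i)))

/-- The neighborhood of the image of a long edge, together with the components at its leaves. -/
def hat (G' : SimpleGraph W) (q : ℕ) (φ : Node n ⊕ LongEdge n × Fin L → W) (e : LongEdge n) :
    Set W :=
  thick G' φ q (closedPath LongEdge.src LongEdge.tgt L e) ∪
    ⋃ i ∈ {i | .leaf i ∈ s(e.src, e.tgt)}, leafComp G' q φ i

theorem mem_hat : w ∈ hat G' q φ e ↔
    w ∈ thick G' φ q (closedPath LongEdge.src LongEdge.tgt L e) ∨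
      ∃ i, .leaf i ∈ s(e.src, e.tgt) ∧ w ∈ leafComp G' q φ i := by
  simp only [hat, Set.mem_union, Set.mem_iUnion, exists_prop, Set.mem_ofPred_eq]

theorem map_mem_hat (hu : u ∈ s(e.src, e.tgt)) : φ (.inl u) ∈ hat G' q φ e :=
  mem_hat.2 (Or.inl (map_mem_thick (inl_mem_closedPath hu)))

theorem leafComp_subset_lowerTree (i : Fin (2 ^ n)) : leafComp G' q φ i ⊆ lowerTree G' q φ :=
  componentIn_subset

theorem leafComp_eq (hi : w ∈ leafComp G' q φ i) (hj : w ∈ leafComp G' q φ j) :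
    leafComp G' q φ i = leafComp G' q φ j :=
  (componentIn_eq hi).symm.trans (componentIn_eq hj)

theorem exists_common_end_of_mem_leafComp (hi : .leaf i ∈ s(e.src, e.tgt))
    (hj : .leaf j ∈ s(f.src, f.tgt)) (hwi : w ∈ leafComp G' q φ i) (hwj : w ∈ leafComp G' q φ j) :
    ∃ ℓ, ℓ ∈ e.ends (leafComp G' q φ) ∧ ℓ ∈ f.ends (leafComp G' q φ) :=
  ⟨.inr (leafComp G' q φ i), mem_ends_iff.2 ⟨_, hi, label_leaf i⟩,
    mem_ends_iff.2 ⟨_, hj, by rw [label_leaf, leafComp_eq hwi hwj]⟩⟩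

theorem mem_lowerTree (h : IsQuasiIsometry q (fatGraph n L) G' φ) (hq : 1 ≤ q)
    (hn : q * (radius q + 3 * q) + reach q ≤ n) (hL : n + 1 ≤ L)
    (hu : (tree n).edist u (.leaf i) ≤ reach q) (hw : G'.edist w (φ (.inl u)) ≤ (2 * q : ℕ)) :
    w ∈ lowerTree G' q φ := by
  have le_depth := le_depth_of_edist_leaf_le hu
  refine ⟨?_, fun near_apex => ?_⟩
  · rcases u with k | _ | _ | _
    · exact ⟨k, hw⟩
    all_goals
      simp only [Node.depth] at le_depth
      omega
  · have edist_map_le : G'.edist (φ (.inl u)) (φ (.inl .apex)) ≤ (2 * q + radius q : ℕ) := by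
      rw [SimpleGraph.edist_comm] at hw
      exact SimpleGraph.edist_triangle.trans
        ((add_le_add hw near_apex).trans_eq (by push_cast; rfl))
    have depth_le : u.depth ≤ q * (2 * q + radius q + q) := by
      exact_mod_cast (depth_le_edist_apex hL u).trans (h.edist_le hq edist_map_le)
    rw [show 2 * q + radius q + q = radius q + 3 * q by ring] at depth_le
    omega

theorem map_leaf_mem_leafComp (h : IsQuasiIsometry q (fatGraph n L) G' φ) (hq : 1 ≤ q)
    (hn : q * (radius q + 3 * q) + reach q ≤ n) (hL : n + 1 ≤ L) (i : Fin (2 ^ n)) :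
    φ (.inl (.leaf i)) ∈ leafComp G' q φ i :=
  mem_componentIn_self (mem_lowerTree h hq hn hL (u := .leaf i) (i := i) (by simp) (by simp))

theorem mem_leafComp (h : IsQuasiIsometry q (fatGraph n L) G' φ) (hq : 1 ≤ q)
    (hn : q * (radius q + 3 * q) + reach q ≤ n) (hL : n + 1 ≤ L)
    (hu : (tree n).edist u (.leaf i) ≤ reach q) (hw : G'.edist w (φ (.inl u)) ≤ (2 * q : ℕ)) :
    w ∈ leafComp G' q φ i := by
  let inlHom : tree n →g fatGraph n L := ⟨Sum.inl, id⟩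
  let ball : Set (Node n) := {v | (tree n).edist v (.leaf i) ≤ reach q}
  have preconnected_thick_ball : (G'.induce (thick G' φ q (inlHom '' ball))).Preconnected :=
    h.preconnected_thick (preconnected_induce_image inlHom (preconnected_induce_ball _ _))
  have thick_ball_subset : thick G' φ q (inlHom '' ball) ⊆ lowerTree G' q φ := fun w hw => by
    obtain ⟨_, ⟨v, hv, rfl⟩, hwv⟩ := mem_thick.1 hw
    exact mem_lowerTree h hq hn hL hv hwv
  have leaf_mem_ball : .leaf i ∈ ball := by simp [ball]
  exact subset_componentIn preconnected_thick_ball thick_ball_subset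
    (map_mem_thick (Set.mem_image_of_mem _ leaf_mem_ball)) (map_leaf_mem_leafComp h hq hn hL i)
    (mem_thick.2 ⟨_, Set.mem_image_of_mem _ hu, hw⟩)

theorem label_eq_of_edist_le (h : IsQuasiIsometry q (fatGraph n L) G' φ) (hq : 1 ≤ q)
    (hn : q * (radius q + 3 * q) + reach q ≤ n) (hL : n + 1 ≤ L) (hu : u ∈ s(e.src, e.tgt))
    (hv : v ∈ s(f.src, f.tgt)) (huv : (tree n).edist u v ≤ reach q) :
    label (leafComp G' q φ) u = label (leafComp G' q φ) v := by
  have apex_far : ∀ i, ¬ (tree n).edist .apex (.leaf i) ≤ reach q := fun i hi => by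
    have := Node.depth_apex ▸ le_depth_of_edist_leaf_le hi
    omega
  have hvu : (tree n).edist v u ≤ reach q := by rwa [SimpleGraph.edist_comm]
  rcases eq_apex_or_eq_leaf_or_ne_tree hu with rfl | ⟨i, rfl⟩ | hu
  · rcases eq_apex_or_eq_leaf_or_ne_tree hv with rfl | ⟨j, rfl⟩ | hv
    · rfl
    · exact absurd huv (apex_far j)
    · rw [eq_of_edist_le_of_forall_ne_tree hv hvu]
  · rcases eq_apex_or_eq_leaf_or_ne_tree hv with rfl | ⟨j, rfl⟩ | hv
    · exact absurd hvu (apex_far i)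
    · rw [label_leaf, label_leaf, leafComp_eq (map_leaf_mem_leafComp h hq hn hL i)
        (mem_leafComp h hq hn hL huv (by simp))]
    · rw [eq_of_edist_le_of_forall_ne_tree hv hvu]
  · rw [eq_of_edist_le_of_forall_ne_tree hu huv]

theorem exists_leaf_end (h : IsQuasiIsometry q (fatGraph n L) G' φ) (hq : 1 ≤ q)
    (hn : q * (radius q + 3 * q) + reach q ≤ n) (hL : n + 1 ≤ L) (hw : w ∈ lowerTree G' q φ)
    (hw' : w' ∈ thick G' φ q (closedPath LongEdge.src LongEdge.tgt L e))
    (hww : G'.edist w' w ≤ 1) : ∃ i, .leaf i ∈ s(e.src, e.tgt) ∧ w ∈ leafComp G' q φ i := by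
  obtain ⟨⟨k, hwk⟩, far_apex⟩ := hw
  obtain ⟨z, hz, hwz⟩ := mem_thick.1 hw'
  obtain ⟨v, hv, hvk⟩ := exists_end_near_node (d := reach q) (by omega) hz
    (h.edist_le_of_edist_le_one hq hwz hwk hww)
  have hkv : (tree n).edist (.tree k) v ≤ reach q := by rwa [SimpleGraph.edist_comm]
  rcases eq_apex_or_eq_leaf_or_ne_tree hv with rfl | ⟨i, rfl⟩ | hne
  · refine absurd (SimpleGraph.edist_triangle.trans (add_le_add hwk
      (h.edist_map_le ((edist_inl_le _ _).trans hkv)))) ?_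
    rwa [← Nat.cast_add, show 2 * q + (q * reach q + q) = radius q by rw [radius]; ring]
  · exact ⟨i, hv, mem_leafComp h hq hn hL hkv hwk⟩
  · exact absurd (eq_of_edist_le_of_forall_ne_tree hne hvk) (hne k)

theorem exists_common_end_of_edist_le_one (h : IsQuasiIsometry q (fatGraph n L) G' φ) (hq : 1 ≤ q)
    (hn : q * (radius q + 3 * q) + reach q ≤ n) (hL : n + 1 ≤ L) (hw : w ∈ hat G' q φ e)
    (hw' : w' ∈ hat G' q φ f) (hww : G'.edist w w' ≤ 1) :
    ∃ ℓ, ℓ ∈ e.ends (leafComp G' q φ) ∧ ℓ ∈ f.ends (leafComp G' q φ) := by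
  rcases mem_hat.1 hw with hw | ⟨i, hi, hw⟩ <;> rcases mem_hat.1 hw' with hw' | ⟨j, hj, hw'⟩
  · by_cases hef : e = f
    · subst hef
      exact ⟨_, Sym2.mem_mk_left _ _, Sym2.mem_mk_left _ _⟩
    · obtain ⟨z, hz, hwz⟩ := mem_thick.1 hw
      obtain ⟨z', hz', hwz'⟩ := mem_thick.1 hw'
      obtain ⟨u, hu, v, hv, huv⟩ := exists_ends_near (d := reach q) (by omega) hef hz hz'
        (h.edist_le_of_edist_le_one hq hwz hwz' hww)
      exact ⟨_, mem_ends_iff.2 ⟨u, hu, rfl⟩,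
        mem_ends_iff.2 ⟨v, hv, (label_eq_of_edist_le h hq hn hL hu hv huv).symm⟩⟩
  · obtain ⟨i, hi, hw⟩ := exists_leaf_end h hq hn hL (leafComp_subset_lowerTree j hw') hw hww
    exact exists_common_end_of_mem_leafComp hi hj hw hw'
  · rw [SimpleGraph.edist_comm] at hww
    obtain ⟨j, hj, hw'⟩ := exists_leaf_end h hq hn hL (leafComp_subset_lowerTree i hw) hw' hww
    exact exists_common_end_of_mem_leafComp hi hj hw hw'
  · refine exists_common_end_of_mem_leafComp hi hj (w := w') ?_ hw'
    rcases edist_le_one_iff.1 hww with rfl | hadj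
    · exact hw
    · exact mem_componentIn_of_adj hw (leafComp_subset_lowerTree j hw') hadj

theorem preconnected_hat (h : IsQuasiIsometry q (fatGraph n L) G' φ) (hq : 1 ≤ q)
    (hn : q * (radius q + 3 * q) + reach q ≤ n) (hL : n + 1 ≤ L) (e : LongEdge n) :
    (G'.induce (hat G' q φ e)).Preconnected :=
  preconnected_induce_union_biUnion (h.preconnected_thick (preconnected_closedPath (by omega) e))
    (fun _ _ => preconnected_componentIn _ _) fun i hi =>
      ⟨_, map_mem_thick (inl_mem_closedPath hi), map_leaf_mem_leafComp h hq hn hL i⟩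

theorem hat_inter_hat_nonempty (h : IsQuasiIsometry q (fatGraph n L) G' φ) (hq : 1 ≤ q)
    (hn : q * (radius q + 3 * q) + reach q ≤ n) (hL : n + 1 ≤ L)
    (hef : ∃ ℓ, ℓ ∈ e.ends (leafComp G' q φ) ∧ ℓ ∈ f.ends (leafComp G' q φ)) :
    (hat G' q φ e ∩ hat G' q φ f).Nonempty := by
  obtain ⟨ℓ, he, hf⟩ := hef
  obtain ⟨u, hu, rfl⟩ := mem_ends_iff.1 he
  obtain ⟨v, hv, huv⟩ := mem_ends_iff.1 hf
  rcases eq_or_eq_leaf_of_label_eq huv with rfl | ⟨j, i, rfl, rfl, hij⟩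
  · exact ⟨_, map_mem_hat hu, map_mem_hat hv⟩
  · refine ⟨φ (.inl (.leaf i)), map_mem_hat hu, mem_hat.2 (Or.inr ⟨j, hv, ?_⟩)⟩
    exact hij ▸ map_leaf_mem_leafComp h hq hn hL i

theorem connected_biUnion_hat (h : IsQuasiIsometry q (fatGraph n L) G' φ) (hq : 1 ≤ q)
    (hn : q * (radius q + 3 * q) + reach q ≤ n) (hL : n + 1 ≤ L)
    (hS : ((shareGraph (LongEdge.ends (leafComp G' q φ))).induce S).Connected) :
    (G'.induce (⋃ e ∈ S, hat G' q φ e)).Connected := by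
  obtain ⟨e, he⟩ := hS.nonempty
  refine (SimpleGraph.connected_iff _).2 ⟨preconnected_induce_biUnion hS.preconnected
    (fun e _ => preconnected_hat h hq hn hL e) fun e _ f _ hef => ?_,
    ⟨_, Set.mem_biUnion he (map_mem_hat (Sym2.mem_mk_left _ _))⟩⟩
  refine hat_inter_hat_nonempty h hq hn hL (hef.2.elim id ?_)
  exact fun ⟨ℓ, hf, he⟩ => ⟨ℓ, he, hf⟩

theorem two_le_setDist_biUnion_hat (h : IsQuasiIsometry q (fatGraph n L) G' φ) (hq : 1 ≤ q)
    (hn : q * (radius q + 3 * q) + reach q ≤ n) (hL : n + 1 ≤ L)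
    (hSS' : Disjoint (labels (LongEdge.ends (leafComp G' q φ)) S)
      (labels (LongEdge.ends (leafComp G' q φ)) S')) :
    (2 : ℕ) ≤ setDist G' (⋃ e ∈ S, hat G' q φ e) (⋃ e ∈ S', hat G' q φ e) := by
  rw [le_setDist_iff]
  intro w hw w' hw'
  obtain ⟨e, he, hwe⟩ := Set.mem_iUnion₂.1 hw
  obtain ⟨f, hf, hwf⟩ := Set.mem_iUnion₂.1 hw'
  by_contra hlt
  have edist_le_one : G'.edist w w' ≤ 1 := Order.le_of_lt_add_one (not_le.1 hlt)
  obtain ⟨ℓ, hℓe, hℓf⟩ := exists_common_end_of_edist_le_one h hq hn hL hwe hwf edist_le_one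
  exact Set.disjoint_left.1 hSS' ⟨e, he, hℓe⟩ ⟨f, hf, hℓf⟩

theorem isFatMinor_of_isQuasiIsometry (h : IsQuasiIsometry q (fatGraph n L) G' φ)
    (hq : 1 ≤ q) (hn : q * (radius q + 3 * q) + reach q ≤ n) (hL : n + 1 ≤ L) :
    IsFatMinor 2 linkedK15 G' := by
  obtain ⟨B, P, M⟩ := exists_isLabelModel (leafComp G' q φ)
  exact ⟨fun v => ⋃ e ∈ B v, hat G' q φ e, fun e => ⋃ f ∈ P e, hat G' q φ f, {
    connected_branch := fun v => connected_biUnion_hat h hq hn hL (M.connected_branch v)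
    connected_edge := fun e => connected_biUnion_hat h hq hn hL (M.connected_edge e)
    meet := fun v e hv => by
      obtain ⟨ℓ, ⟨a, ha, hℓa⟩, b, hb, hℓb⟩ := M.meet v e hv
      obtain ⟨w, hwa, hwb⟩ := hat_inter_hat_nonempty h hq hn hL ⟨ℓ, hℓa, hℓb⟩
      exact ⟨w, Set.mem_biUnion ha hwa, Set.mem_biUnion hb hwb⟩
    branch_branch := fun u v huv =>
      two_le_setDist_biUnion_hat h hq hn hL (M.disjoint_branch u v huv)
    edge_edge := fun e f hef => two_le_setDist_biUnion_hat h hq hn hL (M.disjoint_edge e f hef)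
    branch_edge := fun v e hv =>
      two_le_setDist_biUnion_hat h hq hn hL (M.disjoint_branch_edge v e hv) }⟩

end Hat

end FatMinor

theorem theorem1 (q : ℕ) (hq : 1 ≤ q) :
    ∃ (V : Type) (_ : Finite V) (G : SimpleGraph V),
      ¬ FatMinor.IsFatMinor 3 FatMinor.linkedK15 G ∧
      ∀ (W : Type*) (G' : SimpleGraph W), FatMinor.IsQuasiIsometric q G G' →
        FatMinor.IsFatMinor 2 FatMinor.linkedK15 G' ∧ FatMinor.IsMinor FatMinor.linkedK15 G' := by
  let n := q * (FatMinor.radius q + 3 * q) + FatMinor.reach q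
  refine ⟨FatMinor.Node n ⊕ FatMinor.LongEdge n × Fin (n + 1), inferInstance,
    FatMinor.fatGraph n (n + 1), FatMinor.not_isFatMinor n (n + 1), ?_⟩
  rintro W G' ⟨φ, hφ⟩
  obtain ⟨B, P, hBP⟩ := FatMinor.isFatMinor_of_isQuasiIsometry hφ hq le_rfl le_rfl
  exact ⟨⟨B, P, hBP⟩, hBP.isMinor one_le_two⟩
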